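/- **Setting.** Let $g:\mathbb R^d\times\mathbb R^p\to\mathbb R^p$, $\Theta_\beta\subseteq\mathbb R^p$ Borel, and let the support have $J^*=\tilde J+J$ points, $J\ge 1$: unobserved points $\tilde S=(s_1,\dots,s_{\tilde J})\in(\mathbb R^d)^{\tilde J}$ and fixed observed points $s_{\tilde J+1},\dots,s_{J^*}\in\mathbb R^d$. Write $\theta^*=(\theta_1,\dots,\theta_{J^*-1})'$, $\theta_{J^*}=1-\sum_{j<J^*}\theta_j$, $g_j=g(s_j,\beta)$, and let $\Theta\subset\mathbb R^{p+(J^*-1)+d\tilde J}$ be the set of all $(\beta,\theta^*,\tilde S)$ with $\beta\in\Theta_\beta$, $\theta_j>0$ for $1\le j\le J^*$, and $\sum_{j=1}^{J^*}\theta_jg_j=0$. Assume that at every point of $\Theta$: $g$ is $C^1$ near $(s_j,\beta)$ for each unobserved $s_j$; $g(s_j,\cdot)$ is $C^1$ near $\beta$ for each observed $s_j$; and $A=\sum_{j=1}^{J^*}\theta_j\,\partial g_j/\partial\beta'$ is invertible. Put $H^*_\beta=(g_1-g_{J^*},\dots,g_{J^*-1}-g_{J^*})$, $\tilde M=\{\theta_1\,\partial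 g_1/\partial s_1',\dots,\theta_{\tilde J}\,\partial g_{\tilde J}/\partial s_{\tilde J}'\}$, $$J_{\theta^*}=-A^{-1}H^*_\beta,\qquad J_{\tilde S}=-A^{-1}\tilde M .$$ $\mathcal H^m$ denotes $m$-dimensional Hausdorff measure, normalized to agree with Lebesgue measure on $\mathbb R^m$; let $N=J^*-1+d\tilde J$. Let $f_S:\mathbb R^d\to[0,\infty]$ be measurable, and let all densities below be nonnegative and measurable. *Conditional densities.* If $\nu$ is a measure on $\Theta$ and $\pi$ is a statistic with values in a Euclidean space, then "the law has conditional density $q$ given $\pi$, with respect to $\nu$" means: there is a disintegration $\nu=\int\kappa_y\,dy$ over Lebesgue measure with $\kappa_y$ carried by $\{\pi=y\}$, such that for almost every $y$ (under the law of $\pi$) the conditional law given $\pi=y$ is $q\,d\kappa_y$. **Claims.** Let $P$ be a probability law of $(\beta,\theta^*,\tilde S)$. 1. If under $P$ the points $s_1,\dots,s_{\tilde J}$ are i.i.d. with Lebesgue density $f_S$, and $p(\beta,\theta^*|\tilde S)$ is the conditional density of $P$ given $\tilde S$ with respect to $\mathcal H^N|_\Theta$, then $P$ has with respect to $\mathcal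 H^N|_\Theta$ the density $$p(\beta,\theta^*,\tilde S)=\Big(\prod_{j=1}^{\tilde J}f_S(s_j)\Big)\,p(\beta,\theta^*|\tilde S).$$ 2. Suppose that $\beta$ is uniquely determined by $(\theta^*,\tilde S)$, i.e. $\beta=\beta(\theta^*,\tilde S)$ for all $(\beta,\theta^*,\tilde S)\in\Theta$. Then, at each point of $\Theta$ with $\beta$ in the interior of $\Theta_\beta$, the function $\beta(\cdot,\cdot)$ is differentiable with $\partial\beta/\partial\theta^{*\prime}=J_{\theta^*}$ and $\partial\beta/\partial\tilde S'=J_{\tilde S}$. Moreover, whenever $P$ has density $\prod_jf_S(s_j)\,p(\beta,\theta^*|\tilde S)$ with respect to $\mathcal H^N|_\Theta$ (in particular in the situation of 1), $(\theta^*,\tilde S)$ has the Lebesgue density $$p(\theta^*,\tilde S)=\big|J_{\theta^*}J_{\theta^*}'+J_{\tilde S}J_{\tilde S}'+I_p\big|^{1/2}\Big(\prod_{j=1}^{\tilde J}f_S(s_j)\Big)p(\beta,\theta^*|\tilde S),\qquad \beta=\beta(\theta^*,\tilde S),$$ on the projection of $\Theta$ to the coordinates $(\theta^*,\tilde S)$,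 and $0$ elsewhere. 3. Suppose that $H^*_\beta$ has full row rank $p$ at every point of $\Theta$ (uniqueness of $\beta$ is not needed here). Let $\nu=\int_{\mathbb R^p}\mathcal H^{N-p}|_{\Theta\cap\{\beta=b\}}\,db$. (a) If under $P$ the parameter $\beta$ has Lebesgue density $p(\beta)$ and is independent of $\tilde S$, the points of $\tilde S$ are i.i.d. with density $f_S$, and $p(\theta^*|\beta,\tilde S)$ is the conditional density of $P$ given $(\beta,\tilde S)$ with respect to $\nu$, then $P$ has density $p(\beta)\,p(\theta^*|\beta,\tilde S)\prod_jf_S(s_j)$ with respect to $\nu$. (b) Whenever $P$ has a density of this form with respect to $\nu$, it has with respect to $\mathcal H^N|_\Theta$ the density $$p(\beta,\theta^*,\tilde S)=\frac{\big|J_{\theta^*}J_{\theta^*}'+J_{\tilde S}J_{\tilde S}'\big|^{1/2}}{\big|J_{\theta^*}J_{\theta^*}'+J_{\tilde S}J_{\tilde S}'+I_p\big|^{1/2}}\;p(\beta)\,p(\theta^*|\beta,\tilde S)\prod_{j=1}^{\tilde J}f_S(s_j).$$ -/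

import Mathlib

open MeasureTheory ProbabilityTheory
open scoped ENNReal Topology

noncomputable section

/-- `q` is a conditional density, given the statistic `π`, of the law `P` with respect to `ν`:
disintegrate the base measure, `ν = ∫ κ_y dy` with `κ_y` carried by the fibre `π = y` and `dy` the
Lebesgue measure on the space of values of `π`; the regular conditional distribution of `x` given
`π x = y` has density `q` with respect to `κ_y`. -/
def IsCondDensity {E Y : Type*} [MeasurableSpace E] [StandardBorelSpace E] [Nonempty E]
    [MeasureSpace Y] (P : Measure E) [IsFiniteMeasure P] (π : E → Y) (ν : Measure E)
    (q : E → ℝ≥0∞) : Prop :=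
  ∃ κ : Kernel Y E,
    (∀ᵐ y : Y, ∀ᵐ x ∂(κ y), π x = y) ∧
    ν = (volume : Measure Y).bind κ ∧
    ∀ᵐ y ∂(P.map π), condDistrib id π P y = (κ y).withDensity q

/-- The Jacobian matrix `∂F/∂x'` of a map between Euclidean spaces. -/
def jacobianMatrix {m n : Type*} [Fintype m] [Fintype n] [DecidableEq n]
    (F : EuclideanSpace ℝ n → EuclideanSpace ℝ m) (x : EuclideanSpace ℝ n) : Matrix m n ℝ :=
  Matrix.of fun r c => fderiv ℝ F x (EuclideanSpace.single c 1) r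

/-- Coordinates of `(θ*, S̃)`. There are `Jt` unobserved and `k + 1` observed support points, so
`θ* = (θ̃, θ)` has `Jt + k` entries (the probability of the last observed point is determined by
the others), and `S̃` consists of `Jt` points of `ℝ^d`. -/
abbrev FreeParam (d Jt k : ℕ) : Type :=
  EuclideanSpace ℝ ((Fin Jt ⊕ Fin k) ⊕ (Fin Jt × Fin d))

/-- Coordinates of `(β, θ*, S̃)`, with the Euclidean distance. -/
abbrev FullParam (p d Jt k : ℕ) : Type :=
  EuclideanSpace ℝ (Fin p ⊕ ((Fin Jt ⊕ Fin k) ⊕ (Fin Jt × Fin d)))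

namespace FreeParam

variable {d Jt k : ℕ}

/-- The vector `θ*` of probabilities of all support points but the last one. -/
def theta (l : FreeParam d Jt k) (c : Fin Jt ⊕ Fin k) : ℝ := l (Sum.inl c)

/-- The probability of the last support point. -/
def thetaLast (l : FreeParam d Jt k) : ℝ := 1 - ∑ c, l.theta c

/-- The unobserved support points `S̃`. -/
def missing (l : FreeParam d Jt k) (j : Fin Jt) : EuclideanSpace ℝ (Fin d) :=
  WithLp.toLp 2 fun i => l (Sum.inr (j, i))

end FreeParam

namespace FullParam

variable {p d Jt k : ℕ}

/-- The component `β` of `(β, θ*, S̃)`. -/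
def beta (x : FullParam p d Jt k) : EuclideanSpace ℝ (Fin p) :=
  WithLp.toLp 2 fun i => x (Sum.inl i)

/-- The component `(θ*, S̃)` of `(β, θ*, S̃)`. -/
def free (x : FullParam p d Jt k) : FreeParam d Jt k :=
  WithLp.toLp 2 fun i => x (Sum.inr i)

/-- The component `S̃` of `(β, θ*, S̃)`. -/
def missing (x : FullParam p d Jt k) : Fin Jt → EuclideanSpace ℝ (Fin d) := x.free.missing

end FullParam

/-- The data of a just identified moment condition model: the moment function `g(s, β)`, the
`k + 1` observed support points, and the set in which `β` is allowed to lie. -/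
structure MomentModel (p d k : ℕ) where
  g : EuclideanSpace ℝ (Fin d) → EuclideanSpace ℝ (Fin p) → EuclideanSpace ℝ (Fin p)
  s : Fin (k + 1) → EuclideanSpace ℝ (Fin d)
  betaSet : Set (EuclideanSpace ℝ (Fin p))

namespace MomentModel

variable {p d Jt k : ℕ} (M : MomentModel p d k)

/-- The last (observed) support point. -/
def sLast : EuclideanSpace ℝ (Fin d) := M.s (Fin.last k)

/-- All support points but the last one: first the unobserved, then the observed ones. -/
def point (l : FreeParam d Jt k) : Fin Jt ⊕ Fin k → EuclideanSpace ℝ (Fin d) :=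
  Sum.elim l.missing fun i => M.s i.castSucc

/-- The parameter space `Θ_{β,θ*,S̃}`: the moment conditions and the probability axioms hold. -/
def paramSpace (Jt : ℕ) : Set (FullParam p d Jt k) :=
  {x | x.beta ∈ M.betaSet ∧ (∀ c, 0 < x.free.theta c) ∧ 0 < x.free.thetaLast ∧
    ∑ c, x.free.theta c • M.g (M.point x.free c) x.beta
      + x.free.thetaLast • M.g M.sLast x.beta = 0}

/-- `∑_j θ_j ∂g_j/∂β'`. -/
def meanJac (x : FullParam p d Jt k) : Matrix (Fin p) (Fin p) ℝ :=
  ∑ c, x.free.theta c • jacobianMatrix (M.g (M.point x.free c)) x.beta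
    + x.free.thetaLast • jacobianMatrix (M.g M.sLast) x.beta

/-- `H*_β`, whose columns are `g_j - g_{J*}`. -/
def H (x : FullParam p d Jt k) : Matrix (Fin p) (Fin Jt ⊕ Fin k) ℝ :=
  Matrix.of fun r c => M.g (M.point x.free c) x.beta r - M.g M.sLast x.beta r

/-- `M̃ = {θ_1 ∂g_1/∂s_1', …}`, the blocks running over the unobserved points. -/
def Mtilde (x : FullParam p d Jt k) : Matrix (Fin p) (Fin Jt × Fin d) ℝ :=
  Matrix.of fun r jc => x.free.theta (Sum.inl jc.1) *
    jacobianMatrix (fun s => M.g s x.beta) (x.missing jc.1) r jc.2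

/-- `J_{θ*} = -(∑_j θ_j ∂g_j/∂β')⁻¹ H*_β`. -/
def JTheta (x : FullParam p d Jt k) : Matrix (Fin p) (Fin Jt ⊕ Fin k) ℝ :=
  -((M.meanJac x)⁻¹ * M.H x)

/-- `J_{S̃} = -(∑_j θ_j ∂g_j/∂β')⁻¹ M̃`. -/
def JS (x : FullParam p d Jt k) : Matrix (Fin p) (Fin Jt × Fin d) ℝ :=
  -((M.meanJac x)⁻¹ * M.Mtilde x)

/-- `J_{θ*} J_{θ*}' + J_{S̃} J_{S̃}'`. -/
def gram (x : FullParam p d Jt k) : Matrix (Fin p) (Fin p) ℝ :=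
  M.JTheta x * (M.JTheta x).transpose + M.JS x * (M.JS x).transpose

/-- The Hausdorff measure of dimension `J* - 1 + d J̃` on `Θ_{β,θ*,S̃}`. -/
def hausdorff (Jt : ℕ) : Measure (FullParam p d Jt k) :=
  (μHE[(Jt + k) + Jt * d] : Measure (FullParam p d Jt k)).restrict (M.paramSpace Jt)

/-- The measure `∫ ℋ_b db`, where `db` is the Lebesgue measure on `ℝ^p` and `ℋ_b` is the Hausdorff
measure of dimension `J* - 1 + d J̃ - p` on the slice `{β = b}` of `Θ_{β,θ*,S̃}`. -/
def slicedHausdorff (Jt : ℕ) : Measure (FullParam p d Jt k) :=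
  (volume : Measure (EuclideanSpace ℝ (Fin p))).bind fun b =>
    (μHE[(Jt + k) + Jt * d - p] : Measure (FullParam p d Jt k)).restrict
      (M.paramSpace Jt ∩ {x | x.beta = b})

/-- `f_S` is the common Lebesgue density of the unobserved support points, which are i.i.d.
under the law `P` of `(β, θ*, S̃)`. -/
def MissingIID {p d Jt k : ℕ} (P : Measure (FullParam p d Jt k))
    (fS : EuclideanSpace ℝ (Fin d) → ℝ≥0∞) : Prop :=
  iIndepFun (fun (j : Fin Jt) (x : FullParam p d Jt k) => x.missing j) P ∧
    ∀ j : Fin Jt, P.map (fun x => x.missing j) = volume.withDensity fS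

end MomentModel

end

/-! Let `J` be the matrix of `J_{θ*}` and `J_{S̃}` side by side. Differentiating the moment
condition and inverting `A` shows that the tangent space of `Θ` at each of its points is the graph
`{(J w, w)}` over the coordinates `w` of `(θ*, S̃)`. Both density formulas compare volumes on this
graph.

The parametrization `w ↦ (J w, w)` has Gram matrix `1 + J'J`, and `det (1 + J'J) = det (1 + JJ')` by
Sylvester's identity. If `β` is a function of `(θ*, S̃)`, the area formula turns integrals over `Θ`
into Lebesgue integrals with the factor `√det (JJ' + 1)`. The derivative of `β(·,·)` is that of the
implicit function, with which it must coincide by uniqueness.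

Slicing by `β` is a coarea formula. When `J` has rank `p`, `Θ` is locally parametrized by `β` and `N
- p` further linear coordinates of `w`. The area formula for `Θ` and for each slice, joined by
Tonelli's theorem, reduces the claim to a Gram determinant identity
(`Matrix.det_gram_right_inverse`), whose outcome is the factor `√det JJ' / √det (JJ' + 1)`. No
uniqueness of `β` is involved, because the argument is local and countably many pieces are summed.

The statements on conditional densities are separate and purely measure-theoretic
(`IsCondDensity.eq_withDensity`). The geometry is carried by `lintegral_hausdorff_image_eq`,
`exists_local_parametrization`, `IsImplicitGraph.lintegral_eq` and `IsImplicitGraph.bind_slices_eq`;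
`MomentModel.isImplicitGraph` connects them to the model. -/

/-! ### Area formula for injective immersions -/

section AreaFormula

open Module Set Filter
open scoped NNReal

/-- A measurable set which is locally good is a countable disjoint union of good measurable
sets. -/
theorem MeasurableSet.exists_partition_of_locally {X : Type*} [TopologicalSpace X]
    [SecondCountableTopology X] [MeasurableSpace X] [OpensMeasurableSpace X] {S : Set X}
    (hS : MeasurableSet S) {Q : Set X → Prop} (hQ : Q ∅)
    (h : ∀ x ∈ S, ∃ V ∈ 𝓝 x, ∀ T ⊆ S ∩ V, MeasurableSet T → Q T) :
    ∃ t : ℕ → Set X, (∀ i, MeasurableSet (t i)) ∧ Pairwise (Function.onFun Disjoint t) ∧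
      ⋃ i, t i = S ∧ ∀ i, ∀ T ⊆ t i, MeasurableSet T → Q T := by
  have h' : ∀ x, ∃ V : Set X, x ∈ S → V ∈ 𝓝 x ∧ ∀ T ⊆ S ∩ V, MeasurableSet T → Q T := fun x => by
    by_cases hx : x ∈ S
    · obtain ⟨V, hV, hT⟩ := h x hx
      exact ⟨V, fun _ => ⟨hV, hT⟩⟩
    · exact ⟨∅, fun hx' => absurd hx' hx⟩
  choose V hV using h'
  obtain ⟨s, hsS, hs, hcov⟩ := TopologicalSpace.countable_cover_nhdsWithin
    (f := fun x => interior (V x))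
    fun x hx => mem_nhdsWithin_of_mem_nhds (interior_mem_nhds.2 (hV x hx).1)
  rcases s.eq_empty_or_nonempty with rfl | hne
  · refine ⟨fun _ => ∅, fun _ => MeasurableSet.empty, fun _ _ _ => disjoint_bot_left, ?_,
      fun _ T hT _ => ?_⟩
    · simpa [eq_comm, subset_empty_iff] using hcov
    · rwa [subset_empty_iff.1 hT]
  obtain ⟨u, rfl⟩ := hs.exists_eq_range hne
  refine ⟨fun i => S ∩ disjointed (fun i => interior (V (u i))) i, fun i => hS.inter
    (MeasurableSet.disjointed (fun i => isOpen_interior.measurableSet) i), fun i j hij =>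
      ((disjoint_disjointed _) hij).mono inter_subset_right inter_subset_right, ?_,
      fun i T hT hTm => (hV (u i) (hsS ⟨i, rfl⟩)).2 T (hT.trans ?_) hTm⟩
  · rw [← inter_iUnion, iUnion_disjointed, inter_eq_left]
    simpa [iUnion_range_eq_iUnion] using hcov
  · exact inter_subset_inter_right _ ((disjointed_subset _ i).trans interior_subset)

/-- A measure which is locally dominated, up to factors arbitrarily close to one, by another
measure is dominated by it. -/
theorem MeasureTheory.Measure.le_of_locally_le_pow_mul {X : Type*} [TopologicalSpace X]
    [SecondCountableTopology X] [MeasurableSpace X] [OpensMeasurableSpace X]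
    {μ ν : Measure X} (n : ℕ)
    (h : ∀ a : ℝ≥0, 1 < a → ∀ x, ∃ V ∈ 𝓝 x, ∀ T ⊆ V, MeasurableSet T →
      μ T ≤ (a : ℝ≥0∞) ^ n * ν T) : μ ≤ ν := by
  refine Measure.le_iff.2 fun T hT => ?_
  have key : ∀ a : ℝ≥0, 1 < a → μ T ≤ (a : ℝ≥0∞) ^ n * ν T := by
    intro a ha
    obtain ⟨t, htm, hdis, hun, hle⟩ := hT.exists_partition_of_locally
      (Q := fun T => μ T ≤ (a : ℝ≥0∞) ^ n * ν T) (by simp) fun x _ =>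
        (h a ha x).imp fun V hV => ⟨hV.1, fun T hT => hV.2 T (hT.trans inter_subset_right)⟩
    rw [← hun, measure_iUnion hdis htm, measure_iUnion hdis htm, ← ENNReal.tsum_mul_left]
    exact ENNReal.tsum_le_tsum fun i => hle i _ subset_rfl (htm i)
  have hlim : Tendsto (fun a : ℝ≥0 => (a : ℝ≥0∞) ^ n * ν T) (𝓝[>] 1)
      (𝓝 (((1 : ℝ≥0) : ℝ≥0∞) ^ n * ν T)) := by
    refine ENNReal.Tendsto.mul_const ?_ (Or.inl (by simp))
    exact ((ENNReal.continuous_pow n).comp ENNReal.continuous_coe).continuousAt.mono_left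
      nhdsWithin_le_nhds
  have := ge_of_tendsto hlim (eventually_nhdsWithin_of_forall key)
  simpa using this

/-- The bound forces `v` to be constant where `u` is, so on `T` the map `v` factors through `u` by a
`K`-Lipschitz map. The symmetric form allows a map and its linearization to be exchanged. -/
theorem euclideanHausdorffMeasure_image_le_of_edist_le {X Y Z : Type*}
    [PseudoEMetricSpace X] [EMetricSpace Y] [MeasurableSpace Y] [BorelSpace Y]
    [EMetricSpace Z] [MeasurableSpace Z] [BorelSpace Z] (n : ℕ) {u : X → Y} {v : X → Z}
    {T : Set X} {K : ℝ≥0} (h : ∀ x ∈ T, ∀ y ∈ T, edist (v x) (v y) ≤ K * edist (u x) (u y)) :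
    (μHE[n] : Measure Z) (v '' T) ≤ (K : ℝ≥0∞) ^ n * (μHE[n] : Measure Y) (u '' T) := by
  rcases T.eq_empty_or_nonempty with rfl | ⟨x₀, hx₀⟩
  · simp
  have : Nonempty X := ⟨x₀⟩
  let w : Y → Z := fun y => v (Function.invFunOn u T y)
  have hmem : ∀ x ∈ T, Function.invFunOn u T (u x) ∈ T := fun x hx =>
    Function.invFunOn_mem ⟨x, hx, rfl⟩
  have heq : ∀ x ∈ T, u (Function.invFunOn u T (u x)) = u x := fun x hx =>
    Function.invFunOn_eq ⟨x, hx, rfl⟩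
  have hw : ∀ x ∈ T, w (u x) = v x := by
    intro x hx
    have := h _ (hmem x hx) x hx
    rw [heq x hx, edist_self, mul_zero, nonpos_iff_eq_zero] at this
    exact edist_eq_zero.1 this
  have hlip : LipschitzOnWith K w (u '' T) := by
    rintro _ ⟨x, hx, rfl⟩ _ ⟨y, hy, rfl⟩
    rw [hw x hx, hw y hy]
    exact h x hx y hy
  have him : v '' T = w '' (u '' T) := by
    rw [image_image]; exact image_congr fun x hx => (hw x hx).symm
  have := hlip.hausdorffMeasure_image_le (d := n) (by positivity)
  rw [him, Measure.euclideanHausdorffMeasure_def, Measure.euclideanHausdorffMeasure_def,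
    Measure.smul_apply, Measure.smul_apply, ENNReal.smul_def, ENNReal.smul_def, smul_eq_mul,
    smul_eq_mul, mul_left_comm]
  gcongr
  simpa using this

/-- A derivative is continuous, along any set, at points of strict differentiability. -/
theorem HasStrictFDerivAt.eventually_norm_sub_le {E F : Type*} [NormedAddCommGroup E]
    [NormedSpace ℝ E] [NormedAddCommGroup F] [NormedSpace ℝ F] {f : E → F} {A : E →L[ℝ] F} {x : E}
    (hf : HasStrictFDerivAt f A x) {c : ℝ≥0} (hc : 0 < c) :
    ∀ᶠ y in 𝓝 x, ∀ B : E →L[ℝ] F, HasFDerivAt f B y → ‖B - A‖ ≤ c := by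
  obtain ⟨s, hs, hap⟩ := hf.approximates_deriv_on_nhds (c := c) (Or.inr hc)
  filter_upwards [eventually_mem_nhds_iff.2 hs] with y hy B hB
  have hB' : HasFDerivAt (f - ⇑A) (B - A) y := hB.sub A.hasFDerivAt
  exact hB'.le_of_lipschitzOn hy hap.lipschitzOnWith

/-- `S` need not be open: strict differentiability at one point already controls every derivative
that exists nearby. -/
theorem continuousOn_of_hasStrictFDerivAt {E F : Type*} [NormedAddCommGroup E]
    [NormedSpace ℝ E] [NormedAddCommGroup F] [NormedSpace ℝ F] {f : E → F} {f' : E → E →L[ℝ] F}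
    {S : Set E} (hf : ∀ x ∈ S, HasStrictFDerivAt f (f' x) x) : ContinuousOn f' S := by
  intro x hx
  refine Metric.tendsto_nhds.2 fun ε hε => ?_
  have := (hf x hx).eventually_norm_sub_le (c := ⟨ε / 2, by positivity⟩) (half_pos hε)
  filter_upwards [nhdsWithin_le_nhds this, self_mem_nhdsWithin] with y hy hyS
  rw [dist_eq_norm]
  exact (hy _ (hf y hyS).hasFDerivAt).trans_lt (half_lt_self hε)

variable {E F : Type*} [NormedAddCommGroup E] [InnerProductSpace ℝ E] [FiniteDimensional ℝ E]
  [NormedAddCommGroup F] [InnerProductSpace ℝ F]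

/-- In an orthonormal basis `normDet` is the square root of a Gram determinant, hence of a
polynomial in inner products of images. -/
theorem ContinuousLinearMap.continuous_normDet :
    Continuous fun f : E →L[ℝ] F => (f : E →ₗ[ℝ] F).normDet := by
  let b := stdOrthonormalBasis ℝ E
  have h : (fun f : E →L[ℝ] F => (f : E →ₗ[ℝ] F).normDet) =
      fun f : E →L[ℝ] F => Real.sqrt (Matrix.gram ℝ (f <| b ·)).det := by
    funext f
    have := (f : E →ₗ[ℝ] F).normDet_sq_eq_det_gram b
    rw [show (Matrix.gram ℝ (f <| b ·)).det = ((f : E →ₗ[ℝ] F).normDet) ^ 2 from this.symm,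
      Real.sqrt_sq (LinearMap.normDet_nonneg _)]
  rw [h]
  refine Real.continuous_sqrt.comp (Continuous.matrix_det ?_)
  refine continuous_matrix fun i j => ?_
  simp only [Matrix.gram_apply]
  fun_prop

theorem LinearMap.normDet_pos_of_injective {f : E →ₗ[ℝ] F} (hf : Function.Injective f) :
    0 < f.normDet := by
  refine lt_of_le_of_ne f.normDet_nonneg (Ne.symm ?_)
  exact (f.normDet_ne_zero_tfae.out 4 0).1 hf

/-- Near a point of strict differentiability with injective derivative, a map distorts distances
like its derivative, up to a factor close to one. -/
theorem HasStrictFDerivAt.eventually_edist_le {f : E → F} {A : E →L[ℝ] F} {x : E}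
    (hf : HasStrictFDerivAt f A x) (hA : Function.Injective A) {a : ℝ≥0} (ha : 1 < a) :
    ∃ V ∈ 𝓝 x, ∀ y ∈ V, ∀ z ∈ V, edist (f y) (f z) ≤ a * edist (A y) (A z) ∧
      edist (A y) (A z) ≤ a * edist (f y) (f z) := by
  obtain ⟨K, hK, hanti⟩ := (A : E →ₗ[ℝ] F).exists_antilipschitzWith (LinearMap.ker_eq_bot.2 hA)
  have ha0 : (0 : ℝ) < a := by
    have : (1 : ℝ) < a := by exact_mod_cast ha
    linarith
  have ha1 : (1 : ℝ) < a := by exact_mod_cast ha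
  have hK' : (0 : ℝ) < K := by exact_mod_cast hK
  -- With `δ K = 1 - 1/a` the linearization error is at most `(1 - 1/a) ‖A (y - z)‖`. This leaves
  -- the factors `1/a` from below and `2 - 1/a ≤ a` from above.
  let δ : ℝ := (1 - 1 / a) / K
  have hδ : 0 < δ := div_pos (sub_pos.2 ((div_lt_one ha0).2 ha1)) hK'
  obtain ⟨V, hV, hap⟩ := hf.approximates_deriv_on_nhds (c := ⟨δ, hδ.le⟩) (Or.inr hδ)
  refine ⟨V, hV, fun y hy z hz => ?_⟩
  have h1 : ‖f y - f z - A (y - z)‖ ≤ δ * ‖y - z‖ := hap y hy z hz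
  have h2 : ‖y - z‖ ≤ K * ‖A (y - z)‖ := by
    have := hanti.le_mul_dist y z
    simpa [dist_eq_norm] using this
  have h3 : ‖f y - f z - A (y - z)‖ ≤ (1 - 1 / a) * ‖A (y - z)‖ := by
    calc _ ≤ δ * (K * ‖A (y - z)‖) := h1.trans (by gcongr)
      _ = _ := by simp only [δ]; field_simp
  have h4 : ‖f y - f z‖ ≤ ‖A (y - z)‖ + ‖f y - f z - A (y - z)‖ := by
    have := norm_add_le (A (y - z)) (f y - f z - A (y - z))
    rwa [add_sub_cancel] at this
  have h5 : ‖A (y - z)‖ ≤ ‖f y - f z‖ + ‖f y - f z - A (y - z)‖ := by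
    have := norm_sub_le (f y - f z) (f y - f z - A (y - z))
    rwa [sub_sub_cancel] at this
  have h6 : 2 - 1 / (a : ℝ) ≤ a := by
    rw [sub_le_iff_le_add, ← sub_nonneg]
    have : (a : ℝ) + 1 / a - 2 = (a - 1) ^ 2 / a := by field_simp; ring
    rw [this]; positivity
  have hAn := norm_nonneg (A (y - z))
  constructor
  · rw [edist_dist, edist_dist, ← ENNReal.ofReal_coe_nnreal, ← ENNReal.ofReal_mul a.coe_nonneg]
    refine ENNReal.ofReal_le_ofReal ?_
    rw [dist_eq_norm, dist_eq_norm, ← map_sub]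
    nlinarith
  · rw [edist_dist, edist_dist, ← ENNReal.ofReal_coe_nnreal, ← ENNReal.ofReal_mul a.coe_nonneg]
    refine ENNReal.ofReal_le_ofReal ?_
    rw [dist_eq_norm, dist_eq_norm, ← map_sub]
    have h7 : 1 / (a : ℝ) * ‖A (y - z)‖ ≤ ‖f y - f z‖ := by linarith
    rw [one_div, inv_mul_le_iff₀ ha0] at h7
    exact h7

variable [MeasurableSpace E] [BorelSpace E] [MeasurableSpace F] [BorelSpace F]

/-- The linear image `f' x '' T` has measure exactly `normDet` times volume. Replacing `f` by `f' x`
costs `a` to the power of the dimension, and freezing the continuous density at `x` costs one more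
factor `a`. -/
theorem HasStrictFDerivAt.exists_nhds_hausdorff_image_comparison {f : E → F} {f' : E → E →L[ℝ] F}
    {S : Set E} (hf : ∀ x ∈ S, HasStrictFDerivAt f (f' x) x)
    (hinj : ∀ x ∈ S, Function.Injective (f' x)) {a : ℝ≥0} (ha : 1 < a) {x : E} (hx : x ∈ S) :
    ∃ V ∈ 𝓝[S] x, ∀ T ⊆ V ∩ S, MeasurableSet T →
      (μHE[finrank ℝ E] : Measure F) (f '' T) ≤
        (a : ℝ≥0∞) ^ (finrank ℝ E + 1) *
          ∫⁻ y in T, ENNReal.ofReal (f' y : E →ₗ[ℝ] F).normDet ∧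
      ∫⁻ y in T, ENNReal.ofReal (f' y : E →ₗ[ℝ] F).normDet ≤
        (a : ℝ≥0∞) ^ (finrank ℝ E + 1) * (μHE[finrank ℝ E] : Measure F) (f '' T) := by
  obtain ⟨V, hV, hdist⟩ := (hf x hx).eventually_edist_le (hinj x hx) ha
  set j : E → ℝ := fun y => (f' y : E →ₗ[ℝ] F).normDet with hj
  have hjc : ContinuousOn j S :=
    ContinuousLinearMap.continuous_normDet.comp_continuousOn (continuousOn_of_hasStrictFDerivAt hf)
  have hpos : 0 < j x := LinearMap.normDet_pos_of_injective (hinj x hx)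
  have ha1 : (1 : ℝ) < a := by exact_mod_cast ha
  have hev1 : ∀ᶠ y in 𝓝[S] x, j y < a * j x :=
    (hjc x hx).eventually_lt_const (by nlinarith)
  have hev2 : ∀ᶠ y in 𝓝[S] x, j x < a * j y :=
    ((hjc x hx).const_mul (a : ℝ)).eventually_const_lt (by nlinarith)
  refine ⟨V ∩ {y | j y < a * j x ∧ j x < a * j y},
    Filter.inter_mem (mem_nhdsWithin_of_mem_nhds hV) (hev1.and hev2), fun T hT hTm => ?_⟩
  have hvol : (μHE[finrank ℝ E] : Measure F) (f' x '' T) = ENNReal.ofReal (j x) * volume T :=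
    (f' x : E →ₗ[ℝ] F).euclideanHausdorffMeasure_image_eq_normDet_mul_volume T
  have hconst : ∀ c : ℝ≥0∞, c * volume T = ∫⁻ _ in T, c := fun c => by simp
  constructor
  · calc _ ≤ (a : ℝ≥0∞) ^ finrank ℝ E * (ENNReal.ofReal (j x) * volume T) := by
          rw [← hvol]
          exact euclideanHausdorffMeasure_image_le_of_edist_le _ fun y hy z hz =>
            (hdist y (hT hy).1.1 z (hT hz).1.1).1
      _ ≤ (a : ℝ≥0∞) ^ finrank ℝ E * (a * ∫⁻ y in T, ENNReal.ofReal (j y)) := by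
          refine mul_le_mul' le_rfl ?_
          rw [hconst, ← lintegral_const_mul' _ _ ENNReal.coe_ne_top]
          refine setLIntegral_mono' hTm fun y hy => ?_
          rw [← ENNReal.ofReal_coe_nnreal, ← ENNReal.ofReal_mul a.coe_nonneg]
          exact ENNReal.ofReal_le_ofReal (hT hy).1.2.2.le
      _ = _ := by rw [pow_succ, mul_assoc]
  · calc _ ≤ ∫⁻ _ in T, a * ENNReal.ofReal (j x) := by
          refine setLIntegral_mono' hTm fun y hy => ?_
          rw [← ENNReal.ofReal_coe_nnreal, ← ENNReal.ofReal_mul a.coe_nonneg]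
          exact ENNReal.ofReal_le_ofReal (hT hy).1.2.1.le
      _ = a * (μHE[finrank ℝ E] : Measure F) (f' x '' T) := by
          rw [hvol, ← mul_assoc]; simp
      _ ≤ a * ((a : ℝ≥0∞) ^ finrank ℝ E * (μHE[finrank ℝ E] : Measure F) (f '' T)) := by
          gcongr
          exact euclideanHausdorffMeasure_image_le_of_edist_le _ fun y hy z hz =>
            (hdist y (hT hy).1.1 z (hT hz).1.1).2
      _ = _ := by rw [pow_succ', mul_assoc]

/-- **Area formula** for injective immersions. -/
theorem lintegral_hausdorff_image_eq {f : E → F} {f' : E → E →L[ℝ] F}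
    {S : Set E} (hS : MeasurableSet S) (hinjOn : InjOn f S)
    (hf : ∀ x ∈ S, HasStrictFDerivAt f (f' x) x)
    (hinj : ∀ x ∈ S, Function.Injective (f' x)) (h : F → ℝ≥0∞) :
    ∫⁻ z in f '' S, h z ∂(μHE[finrank ℝ E] : Measure F) =
      ∫⁻ y in S, ENNReal.ofReal (f' y : E →ₗ[ℝ] F).normDet * h (f y) := by
  have hcont : ContinuousOn f S := fun x hx => (hf x hx).continuousAt.continuousWithinAt
  have he : MeasurableEmbedding (S.domRestrict f) := hcont.measurableEmbedding hS hinjOn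
  have hv : MeasurableEmbedding ((↑) : S → E) := MeasurableEmbedding.subtype_coe hS
  set J : E → ℝ≥0∞ := fun y => ENNReal.ofReal (f' y : E →ₗ[ℝ] F).normDet with hJ
  -- Both sides become measures on the subtype `S`. There neighbourhoods within `S` are genuine
  -- neighbourhoods and `f` is a measurable embedding, so that no measurability of `h` is needed.
  set μ : Measure S := (μHE[finrank ℝ E] : Measure F).comap (S.domRestrict f) with hμ
  set ν : Measure S := (volume.withDensity J).comap ((↑) : S → E) with hν
  have hμa : ∀ T : Set S, μ T = (μHE[finrank ℝ E] : Measure F) (f '' ((↑) '' T)) := fun T => by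
    rw [hμ, he.comap_apply, image_image]; rfl
  have hνa : ∀ T : Set S, MeasurableSet T → ν T = ∫⁻ y in (↑) '' T, J y := fun T hT => by
    rw [hν, hv.comap_apply, withDensity_apply _ (hv.measurableSet_image' hT)]
  have hsub : ∀ (x : S) (V : Set E) (T : Set S), T ⊆ (↑) ⁻¹' V → ((↑) '' T : Set E) ⊆ V ∩ S := by
    rintro x V T hT _ ⟨y, hy, rfl⟩
    exact ⟨hT hy, y.2⟩
  have hμν : μ = ν := by
    apply le_antisymm
    · refine Measure.le_of_locally_le_pow_mul (finrank ℝ E + 1) fun a ha x => ?_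
      obtain ⟨V, hV, hcomp⟩ :=
        HasStrictFDerivAt.exists_nhds_hausdorff_image_comparison hf hinj ha x.2
      refine ⟨(↑) ⁻¹' V, preimage_coe_mem_nhds_subtype.2 hV, fun T hT hTm => ?_⟩
      rw [hμa, hνa T hTm]
      exact (hcomp _ (hsub x V T hT) (hv.measurableSet_image' hTm)).1
    · refine Measure.le_of_locally_le_pow_mul (finrank ℝ E + 1) fun a ha x => ?_
      obtain ⟨V, hV, hcomp⟩ :=
        HasStrictFDerivAt.exists_nhds_hausdorff_image_comparison hf hinj ha x.2
      refine ⟨(↑) ⁻¹' V, preimage_coe_mem_nhds_subtype.2 hV, fun T hT hTm => ?_⟩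
      rw [hμa, hνa T hTm]
      exact (hcomp _ (hsub x V T hT) (hv.measurableSet_image' hTm)).2
  have hJm : AEMeasurable J (volume.restrict S) := by
    refine ContinuousOn.aemeasurable ?_ hS
    exact ENNReal.continuous_ofReal.comp_continuousOn
      (ContinuousLinearMap.continuous_normDet.comp_continuousOn
        (continuousOn_of_hasStrictFDerivAt hf))
  calc _ = ∫⁻ z, h z ∂(μ.map (S.domRestrict f)) := by
        rw [hμ, he.map_comap, range_domRestrict]
    _ = ∫⁻ y : S, h (f y) ∂ν := by rw [he.lintegral_map, hμν]; rfl
    _ = ∫⁻ y in S, h (f y) ∂(volume.withDensity J) := by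
        rw [← hv.lintegral_map (f := fun y => h (f y)), hν, hv.map_comap, Subtype.range_coe]
    _ = _ := by
        rw [restrict_withDensity hS, lintegral_withDensity_eq_lintegral_mul_non_measurable₀ _ hJm
          (ae_of_all _ fun y => ENNReal.ofReal_lt_top)]
        rfl

end AreaFormula

/-! ### Local parametrization by the inverse function theorem -/

noncomputable section

section Parametrization

open Module Set Filter
open scoped NNReal

/-- Local parametrization of a zero set of `F` by complementary linear coordinates `L`, at a point
where the derivative of `(F, L)` is invertible. -/
theorem exists_local_parametrization {X Y Z : Type*} [NormedAddCommGroup X] [NormedSpace ℝ X]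
    [CompleteSpace X] [NormedAddCommGroup Y] [NormedSpace ℝ Y] [CompleteSpace Y]
    [NormedAddCommGroup Z] [NormedSpace ℝ Z] [CompleteSpace Z] {F : X → Z} {F' : X → X →L[ℝ] Z}
    {S : Set X} (hF : ∀ x ∈ S, HasStrictFDerivAt F (F' x) x) (L : X →L[ℝ] Y) {x₀ : X}
    (hx₀ : x₀ ∈ S) (hzero : F x₀ = 0) (hbij : Function.Bijective ((F' x₀).prod L)) :
    ∃ W ∈ 𝓝 x₀, ∃ f : Y → X, ContinuousAt f (L x₀) ∧
      (∀ᶠ y in 𝓝 (L x₀), F (f y) = 0 ∧ L (f y) = y) ∧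
      (∀ x ∈ W, F x = 0 → f (L x) = x) ∧
      ∀ x ∈ S ∩ W, F x = 0 → ∃ f' : Y →L[ℝ] X, HasStrictFDerivAt f f' (L x) ∧
        (F' x).comp f' = 0 ∧ L.comp f' = ContinuousLinearMap.id ℝ Y := by
  let e₀ : X ≃L[ℝ] Z × Y := ContinuousLinearEquiv.ofBijective ((F' x₀).prod L)
    (LinearMap.ker_eq_bot.2 hbij.1) (LinearMap.range_eq_top.2 hbij.2)
  have he₀ : (e₀ : X →L[ℝ] Z × Y) = (F' x₀).prod L := rfl
  have hΦ : ∀ x ∈ S, HasStrictFDerivAt (fun x => (F x, L x)) ((F' x).prod L) x := fun x hx =>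
    (hF x hx).prodMk L.hasStrictFDerivAt
  have h₀ : HasStrictFDerivAt (fun x => (F x, L x)) (e₀ : X →L[ℝ] Z × Y) x₀ := hΦ x₀ hx₀
  let Φ : OpenPartialHomeomorph X (Z × Y) := h₀.toOpenPartialHomeomorph _
  have hΦc : ∀ x, Φ x = (F x, L x) := fun x => rfl
  have hsrc : x₀ ∈ Φ.source := h₀.mem_toOpenPartialHomeomorph_source
  have htgt : ((0 : Z), L x₀) ∈ Φ.target := by
    have := Φ.map_source hsrc
    rwa [hΦc, hzero] at this
  -- Invertible operators form an open set, so near `x₀` every derivative of `(F, L)` within `ε` of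
  -- `e₀` is invertible. The neighbourhood below quantifies over all derivatives `B`, as
  -- differentiability is known only on `S`.
  obtain ⟨ε, hε, hball⟩ := Metric.mem_nhds_iff.1 (ContinuousLinearEquiv.nhds e₀)
  have hev := h₀.eventually_norm_sub_le (c := ⟨ε / 2, by positivity⟩) (half_pos hε)
  let ι : Y → Z × Y := fun y => (0, y)
  have hι : Continuous ι := by fun_prop
  refine ⟨Φ.source ∩ {x | ∀ B : X →L[ℝ] Z × Y, HasFDerivAt (fun x => (F x, L x)) B x →
      ‖B - e₀‖ ≤ ε / 2}, Filter.inter_mem (Φ.open_source.mem_nhds hsrc) hev,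
      fun y => Φ.symm (ι y), ?_, ?_, ?_, ?_⟩
  · exact ContinuousAt.comp (f := ι) (Φ.continuousAt_symm htgt) hι.continuousAt
  · have : ∀ᶠ y in 𝓝 (L x₀), ι y ∈ Φ.target :=
      hι.continuousAt.eventually_mem (Φ.open_target.mem_nhds htgt)
    filter_upwards [this] with y hy
    have := Φ.right_inv hy
    rw [hΦc, Prod.ext_iff] at this
    exact this
  · intro x hx hx0
    have := Φ.left_inv hx.1
    rwa [hΦc, hx0] at this
  · intro x hx hx0
    have hd := hΦ x hx.1
    have hmem : (F' x).prod L ∈ Metric.ball (e₀ : X →L[ℝ] Z × Y) ε := by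
      rw [mem_ball_iff_norm]
      exact (hx.2.2 _ hd.hasFDerivAt).trans_lt (half_lt_self hε)
    obtain ⟨e, he⟩ := hball hmem
    have hsymm : Φ.symm (ι (L x)) = x := by
      have := Φ.left_inv hx.2.1
      rwa [hΦc, hx0] at this
    have htx : ι (L x) ∈ Φ.target := by
      have := Φ.map_source hx.2.1
      rwa [hΦc, hx0] at this
    have hds : HasStrictFDerivAt Φ.symm (e.symm : Z × Y →L[ℝ] X) (ι (L x)) := by
      refine Φ.hasStrictFDerivAt_symm htx ?_
      rw [hsymm, he]
      exact hd
    refine ⟨(e.symm : Z × Y →L[ℝ] X).comp (ContinuousLinearMap.inr ℝ Z Y),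
      hds.comp (L x) (ContinuousLinearMap.inr ℝ Z Y).hasStrictFDerivAt, ?_, ?_⟩
    · ext y
      have : ((F' x).prod L) (e.symm (0, y)) = (0, y) := by
        rw [← he]; exact e.apply_symm_apply _
      exact (Prod.ext_iff.1 this).1
    · ext y
      have : ((F' x).prod L) (e.symm (0, y)) = (0, y) := by
        rw [← he]; exact e.apply_symm_apply _
      exact (Prod.ext_iff.1 this).2

end Parametrization

/-! ### Gram determinants and completion of matrices -/

section LinearAlgebra

open Matrix Module

theorem LinearMap.normDet_sq_eq_det_transpose_mul {ι κ : Type*} [Fintype ι] [DecidableEq ι]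
    [Fintype κ] (f : EuclideanSpace ℝ ι →ₗ[ℝ] EuclideanSpace ℝ κ) (D : Matrix κ ι ℝ)
    (hD : ∀ v, (f v).ofLp = D *ᵥ v.ofLp) : f.normDet ^ 2 = (Dᵀ * D).det := by
  have h := f.normDet_sq_eq_det_gram (EuclideanSpace.basisFun ι ℝ)
  rw [show ((f.normDet ^ 2 : ℝ) : ℝ) = f.normDet ^ 2 from rfl] at h
  refine h.trans ?_
  congr 1
  ext i j
  rw [Matrix.gram_apply, EuclideanSpace.basisFun_apply, EuclideanSpace.basisFun_apply,
    EuclideanSpace.inner_eq_star_dotProduct, hD, hD]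
  simp [Matrix.mul_apply, dotProduct, mul_comm]

theorem Matrix.det_mul_transpose_add_one_pos {m n : Type*} [Fintype m] [DecidableEq m] [Fintype n]
    (J : Matrix m n ℝ) : 0 < (J * Jᵀ + 1).det := by
  have h : (J * Jᵀ).PosSemidef := by
    have := Matrix.posSemidef_self_mul_conjTranspose J
    rwa [conjTranspose_eq_transpose_of_trivial] at this
  exact (Matrix.PosDef.posSemidef_add h Matrix.PosDef.one).det_pos

/-- For a right inverse `(C T)` of `(J; Q)`, so that `J C = 1` and `J T = 0`, Gram determinants
satisfy `det (T'T) det (1 + JJ') = det ((C T)'(1 + J'J)(C T)) det (JJ')`. -/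
theorem Matrix.det_gram_right_inverse {m n k : Type*} [Fintype m] [DecidableEq m] [Fintype n]
    [DecidableEq n] [Fintype k] [DecidableEq k] (hcard : Fintype.card m + Fintype.card k =
      Fintype.card n) (J : Matrix m n ℝ) (Q : Matrix k n ℝ) (C : Matrix n m ℝ) (T : Matrix n k ℝ)
    (h : fromRows J Q * fromCols C T = 1) :
    (Tᵀ * T).det * (J * Jᵀ + 1).det =
      ((fromCols C T)ᵀ * (1 + Jᵀ * J) * fromCols C T).det * (J * Jᵀ).det := by
  set N := fromCols C T with hN
  set R := fromRows J Q with hR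
  -- The cardinality condition makes `R` and `N` effectively square, so the one-sided inverse is
  -- two-sided.
  have h' : N * R = 1 := (mul_eq_one_comm_of_card_eq (m ⊕ k) n ℝ (by simp [hcard])).1 h
  have hblocks : fromBlocks (J * C) (J * T) (Q * C) (Q * T) = fromBlocks 1 0 0 1 := by
    rw [fromBlocks_one, ← h, hR, hN, fromRows_mul_fromCols]
  obtain ⟨hJC, hJT, -, -⟩ := fromBlocks_inj.1 hblocks
  have hJN : J * N = fromCols 1 0 := by rw [hN, mul_fromCols, hJC, hJT]
  have hGR : Nᵀ * N * (R * Jᵀ) = (J * N)ᵀ := by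
    rw [Matrix.mul_assoc, ← Matrix.mul_assoc N, h', Matrix.one_mul, transpose_mul]
  -- After factoring out `N'N`, Sylvester's identity moves `JN` past `RJ'`, and `NR = 1` cancels.
  have h1 : (Nᵀ * (1 + Jᵀ * J) * N).det = (Nᵀ * N).det * (J * Jᵀ + 1).det := by
    have : Nᵀ * (1 + Jᵀ * J) * N = Nᵀ * N * (1 + R * Jᵀ * (J * N)) := by
      rw [Matrix.mul_add (Nᵀ * N), Matrix.mul_one, ← Matrix.mul_assoc (Nᵀ * N) (R * Jᵀ), hGR,
        Matrix.mul_add, Matrix.mul_one, Matrix.add_mul, transpose_mul]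
      simp only [Matrix.mul_assoc]
    rw [this, det_mul, det_one_add_mul_comm, Matrix.mul_assoc, ← Matrix.mul_assoc N, h',
      Matrix.one_mul, add_comm]
  -- Cramer's trick: in `N` coordinates, replacing the first block of columns of the identity by
  -- `RJ'` gives a block triangular matrix of determinant `det JJ'`. Its product with `N'N` is block
  -- triangular with determinant `det T'T`.
  have h2 : (Tᵀ * T).det = (Nᵀ * N).det * (J * Jᵀ).det := by
    have hprod : Nᵀ * N * fromCols (R * Jᵀ) (fromRows 0 1) = fromBlocks 1 (Cᵀ * T) 0 (Tᵀ * T) := by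
      rw [mul_fromCols, hGR, hJN, Matrix.mul_assoc, hN, fromCols_mul_fromRows, transpose_fromCols,
        transpose_fromCols, Matrix.mul_zero, Matrix.mul_one, zero_add, fromRows_mul,
        fromCols_fromRows_eq_fromBlocks, transpose_one, transpose_zero]
    have hfac : fromCols (R * Jᵀ) (fromRows 0 1) =
        fromBlocks (J * Jᵀ) 0 (Q * Jᵀ) (1 : Matrix k k ℝ) := by
      rw [hR, fromRows_mul, fromCols_fromRows_eq_fromBlocks]
    have := congrArg Matrix.det hprod
    rw [det_mul, hfac, det_fromBlocks_zero₁₂, det_fromBlocks_zero₂₁] at this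
    simpa using this.symm
  rw [h1, h2]; ring

/-- A matrix with injective transpose can be completed, by rows, to one with trivial kernel. -/
theorem Matrix.exists_fromRows_injective {m n : Type*} [Fintype m] [Fintype n] [DecidableEq n]
    (J : Matrix m n ℝ) (hJ : J.rank = Fintype.card m) :
    ∃ Q : Matrix (Fin (Fintype.card n - Fintype.card m)) n ℝ,
      ∀ v, J *ᵥ v = 0 → Q *ᵥ v = 0 → v = 0 := by
  let K : Submodule ℝ (n → ℝ) := LinearMap.ker J.mulVecLin
  have hK : finrank ℝ K = Fintype.card n - Fintype.card m := by
    have := J.mulVecLin.finrank_range_add_finrank_ker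
    rw [show finrank ℝ (LinearMap.range J.mulVecLin) = J.rank from rfl, hJ] at this
    simp only [finrank_fintype_fun_eq_card] at this
    change _ + finrank ℝ K = _ at this
    omega
  -- `Q` will read off coordinates of a linear retraction onto the kernel of `J`, and so is
  -- injective on that kernel.
  obtain ⟨π, hπ⟩ := LinearMap.exists_leftInverse_of_injective K.subtype K.ker_subtype
  let e := (finBasisOfFinrankEq ℝ K hK).equivFun
  refine ⟨LinearMap.toMatrix' (e.toLinearMap ∘ₗ π), fun v hv hQ => ?_⟩
  rw [LinearMap.toMatrix'_mulVec] at hQ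
  have h1 : π v = 0 := e.map_eq_zero_iff.1 hQ
  have h2 : π (K.subtype ⟨v, hv⟩) = ⟨v, hv⟩ := LinearMap.congr_fun hπ ⟨v, hv⟩
  rw [K.subtype_apply, h1] at h2
  exact (congrArg Subtype.val h2).symm

end LinearAlgebra

end

/-! ### Block coordinates and the area formula for implicit graphs -/

noncomputable section

namespace EuclideanSpace

variable {P N : Type*} [Fintype P] [Fintype N]

/-- The first block of coordinates. -/
def fstL : EuclideanSpace ℝ (P ⊕ N) →L[ℝ] EuclideanSpace ℝ P :=
  (ContinuousLinearMap.fst ℝ _ _).comp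
    (sumEquivProd (𝕜 := ℝ) (ι := P) (κ := N)).toContinuousLinearMap

/-- The second block of coordinates. -/
def sndL : EuclideanSpace ℝ (P ⊕ N) →L[ℝ] EuclideanSpace ℝ N :=
  (ContinuousLinearMap.snd ℝ _ _).comp
    (sumEquivProd (𝕜 := ℝ) (ι := P) (κ := N)).toContinuousLinearMap

/-- The vector with given blocks of coordinates. -/
def glueL : EuclideanSpace ℝ P × EuclideanSpace ℝ N →L[ℝ] EuclideanSpace ℝ (P ⊕ N) :=
  (sumEquivProd (𝕜 := ℝ) (ι := P) (κ := N)).symm.toContinuousLinearMap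

theorem glueL_fstL_sndL (x : EuclideanSpace ℝ (P ⊕ N)) : glueL (fstL x, sndL x) = x :=
  (sumEquivProd (𝕜 := ℝ) (ι := P) (κ := N)).symm_apply_apply x

theorem fstL_glueL (z : EuclideanSpace ℝ P × EuclideanSpace ℝ N) : fstL (glueL z) = z.1 :=
  congrArg Prod.fst ((sumEquivProd (𝕜 := ℝ) (ι := P) (κ := N)).apply_symm_apply z)

theorem sndL_glueL (z : EuclideanSpace ℝ P × EuclideanSpace ℝ N) : sndL (glueL z) = z.2 :=
  congrArg Prod.snd ((sumEquivProd (𝕜 := ℝ) (ι := P) (κ := N)).apply_symm_apply z)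

theorem ofLp_eq_sumElim (x : EuclideanSpace ℝ (P ⊕ N)) :
    x.ofLp = Sum.elim (fstL x).ofLp (sndL x).ofLp := by
  ext (i | i) <;> rfl

theorem glueL_injective :
    Function.Injective (glueL : EuclideanSpace ℝ P × EuclideanSpace ℝ N → _) :=
  (sumEquivProd (𝕜 := ℝ) (ι := P) (κ := N)).symm.injective

/-- Lebesgue measure depends only on coordinates, so the product norm and the Euclidean norm give
the same volume. -/
theorem lintegral_glueL (h : EuclideanSpace ℝ (P ⊕ N) → ℝ≥0∞) :
    ∫⁻ z : EuclideanSpace ℝ P × EuclideanSpace ℝ N, h (glueL z) = ∫⁻ x, h x := by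
  have h1 : MeasurePreserving
      (glueL : EuclideanSpace ℝ P × EuclideanSpace ℝ N → EuclideanSpace ℝ (P ⊕ N)) := by
    have := ((PiLp.volume_preserving_toLp (P ⊕ N)).comp
      (volume_measurePreserving_sumPiEquivProdPi_symm fun _ : P ⊕ N => ℝ)).comp
      ((PiLp.volume_preserving_ofLp P).prod (PiLp.volume_preserving_ofLp N))
    convert this using 1
    · ext z (i | i) <;> rfl
    · exact Measure.volume_eq_prod _ _
  exact h1.lintegral_comp_emb
    (sumEquivProd (𝕜 := ℝ) (ι := P) (κ := N)).symm.toHomeomorph.measurableEmbedding h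

end EuclideanSpace

open EuclideanSpace Matrix Module Set

variable {P N : Type*} [Fintype P] [Fintype N]

/-- `S` is a Borel subset of the zero set of `F`, which near the points of `S` is
a graph over the second block of coordinates, with slope `J`. -/
structure IsImplicitGraph (F : EuclideanSpace ℝ (P ⊕ N) → EuclideanSpace ℝ P)
    (F' : EuclideanSpace ℝ (P ⊕ N) → EuclideanSpace ℝ (P ⊕ N) →L[ℝ] EuclideanSpace ℝ P)
    (J : EuclideanSpace ℝ (P ⊕ N) → Matrix P N ℝ) (S : Set (EuclideanSpace ℝ (P ⊕ N))) :
    Prop where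
  measurableSet : MeasurableSet S
  zero : ∀ x ∈ S, F x = 0
  hasStrictFDerivAt : ∀ x ∈ S, HasStrictFDerivAt F (F' x) x
  apply_eq_zero_iff : ∀ x ∈ S, ∀ v, F' x v = 0 ↔ (fstL v).ofLp = J x *ᵥ (sndL v).ofLp

namespace IsImplicitGraph

variable {F : EuclideanSpace ℝ (P ⊕ N) → EuclideanSpace ℝ P}
  {F' : EuclideanSpace ℝ (P ⊕ N) → EuclideanSpace ℝ (P ⊕ N) →L[ℝ] EuclideanSpace ℝ P}
  {J : EuclideanSpace ℝ (P ⊕ N) → Matrix P N ℝ} {S : Set (EuclideanSpace ℝ (P ⊕ N))}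

theorem mono (hG : IsImplicitGraph F F' J S) {T : Set (EuclideanSpace ℝ (P ⊕ N))}
    (hT : MeasurableSet T) (hTS : T ⊆ S) : IsImplicitGraph F F' J T :=
  ⟨hT, fun x hx => hG.zero x (hTS hx), fun x hx => hG.hasStrictFDerivAt x (hTS hx),
    fun x hx => hG.apply_eq_zero_iff x (hTS hx)⟩

section Graph

/-- On the kernel of `F' x` the second block determines the first through `J`, which gives
injectivity; the dimensions agree. -/
theorem bijective_prod_sndL (hG : IsImplicitGraph F F' J S) {x : EuclideanSpace ℝ (P ⊕ N)}
    (hx : x ∈ S) : Function.Bijective ((F' x).prod sndL) := by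
  have hinj : Function.Injective ((F' x).prod sndL) := by
    refine (injective_iff_map_eq_zero _).2 fun v hv => ?_
    obtain ⟨h1, h2⟩ := Prod.ext_iff.1 hv
    have h2' : sndL v = 0 := h2
    have h3 := (hG.apply_eq_zero_iff x hx v).1 h1
    rw [h2', WithLp.ofLp_zero, mulVec_zero] at h3
    have h4 : fstL v = 0 := by ext i; exact congrFun h3 i
    rw [← glueL_fstL_sndL v, h2', h4]
    exact map_zero glueL
  refine ⟨hinj, (LinearMap.injective_iff_surjective_of_finrank_eq_finrank
    (f := ((F' x).prod sndL).toLinearMap) ?_).1 hinj⟩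
  simp [finrank_prod]

variable [DecidableEq N]

theorem ofLp_apply_of_comp_eq (hG : IsImplicitGraph F F' J S) {x : EuclideanSpace ℝ (P ⊕ N)}
    (hx : x ∈ S) {f' : EuclideanSpace ℝ N →L[ℝ] EuclideanSpace ℝ (P ⊕ N)}
    (h1 : (F' x).comp f' = 0) (h2 : sndL.comp f' = ContinuousLinearMap.id ℝ _)
    (v : EuclideanSpace ℝ N) : (f' v).ofLp = fromRows (J x) 1 *ᵥ v.ofLp := by
  have h3 := (hG.apply_eq_zero_iff x hx (f' v)).1 (DFunLike.congr_fun h1 v)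
  have h4 : sndL (f' v) = v := DFunLike.congr_fun h2 v
  rw [h4] at h3
  rw [ofLp_eq_sumElim (f' v), h3, h4, fromRows_mulVec, one_mulVec]

variable [DecidableEq P]

/-- The matrix of `f'` is `J` stacked on the identity, with Gram matrix `1 + J'J`; Sylvester's
identity passes to `1 + JJ'`. -/
theorem normDet_graph (hG : IsImplicitGraph F F' J S) {x : EuclideanSpace ℝ (P ⊕ N)}
    (hx : x ∈ S) {f' : EuclideanSpace ℝ N →L[ℝ] EuclideanSpace ℝ (P ⊕ N)}
    (h1 : (F' x).comp f' = 0) (h2 : sndL.comp f' = ContinuousLinearMap.id ℝ _) :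
    f'.toLinearMap.normDet = Real.sqrt (J x * (J x)ᵀ + 1).det := by
  have := f'.toLinearMap.normDet_sq_eq_det_transpose_mul
    (fromRows (J x) 1) (hG.ofLp_apply_of_comp_eq hx h1 h2)
  rw [transpose_fromRows, fromCols_mul_fromRows, transpose_one, Matrix.one_mul, add_comm,
    det_one_add_mul_comm, add_comm] at this
  rw [← this, Real.sqrt_sq (LinearMap.normDet_nonneg _)]

/-- The area formula for a graph. -/
theorem lintegral_eq (hG : IsImplicitGraph F F' J S)
    {σ : EuclideanSpace ℝ N → EuclideanSpace ℝ (P ⊕ N)} (hσ : ∀ x ∈ S, σ (sndL x) = x) :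
    MeasurableSet (sndL '' S) ∧ ∀ h : EuclideanSpace ℝ (P ⊕ N) → ℝ≥0∞,
      ∫⁻ x in S, h x ∂(μHE[Fintype.card N] : Measure (EuclideanSpace ℝ (P ⊕ N))) =
        ∫⁻ l in sndL '' S,
          ENNReal.ofReal (Real.sqrt (J (σ l) * (J (σ l))ᵀ + 1).det) * h (σ l) := by
  have hinj : InjOn (sndL : EuclideanSpace ℝ (P ⊕ N) → _) S := fun x hx y hy hxy => by
    rw [← hσ x hx, ← hσ y hy, hxy]
  have hloc : ∀ x ∈ S, ∃ V ∈ 𝓝 x, ∀ T ⊆ S ∩ V, MeasurableSet T →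
      ∀ h : EuclideanSpace ℝ (P ⊕ N) → ℝ≥0∞,
      ∫⁻ x in T, h x ∂(μHE[Fintype.card N] : Measure (EuclideanSpace ℝ (P ⊕ N))) =
        ∫⁻ l in sndL '' T,
          ENNReal.ofReal (Real.sqrt (J (σ l) * (J (σ l))ᵀ + 1).det) * h (σ l) := by
    intro x₀ hx₀
    -- The section `σ` has no assumed regularity. It agrees on `sndL '' T` with the implicit
    -- function `f`, which is strictly differentiable there.
    obtain ⟨W, hW, f, -, -, hf, hf'⟩ := exists_local_parametrization hG.hasStrictFDerivAt sndL hx₀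
      (hG.zero x₀ hx₀) (hG.bijective_prod_sndL hx₀)
    refine ⟨W, hW, fun T hT hTm h => ?_⟩
    have hTS : ∀ x ∈ T, x ∈ S := fun x hx => (hT hx).1
    have hfT : ∀ x ∈ T, f (sndL x) = x := fun x hx => hf x (hT hx).2 (hG.zero x (hTS x hx))
    have hd : ∀ l, ∃ f' : EuclideanSpace ℝ N →L[ℝ] EuclideanSpace ℝ (P ⊕ N), l ∈ sndL '' T →
        HasStrictFDerivAt f f' l ∧ (F' (f l)).comp f' = 0 ∧
          sndL.comp f' = ContinuousLinearMap.id ℝ _ := by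
      intro l
      by_cases hl : l ∈ sndL '' T
      · obtain ⟨x, hx, rfl⟩ := hl
        obtain ⟨f', h'⟩ := hf' x ⟨hTS x hx, (hT hx).2⟩ (hG.zero x (hTS x hx))
        exact ⟨f', fun _ => by rwa [hfT x hx]⟩
      · exact ⟨0, fun h => absurd h hl⟩
    choose f' hf' using hd
    have himage : f '' (sndL '' T) = T := by
      rw [image_image]
      exact (image_congr hfT).trans (image_id T)
    have hinjT : InjOn (sndL : EuclideanSpace ℝ (P ⊕ N) → _) T := hinj.mono hTS
    have hm : MeasurableSet (sndL '' T) :=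
      hTm.image_of_continuousOn_injOn sndL.continuous.continuousOn hinjT
    have harea := lintegral_hausdorff_image_eq (f := f) (f' := f') hm
      (by
        rintro _ ⟨x, hx, rfl⟩ _ ⟨y, hy, rfl⟩ hxy
        rw [hfT x hx, hfT y hy] at hxy
        rw [hxy])
      (fun l hl => (hf' l hl).1)
      (fun l hl => Function.LeftInverse.injective (g := sndL)
        fun v => DFunLike.congr_fun (hf' l hl).2.2 v) h
    rw [himage, finrank_euclideanSpace] at harea
    rw [harea]
    refine setLIntegral_congr_fun hm ?_
    rintro _ ⟨x, hx, rfl⟩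
    have hl : sndL x ∈ sndL '' T := mem_image_of_mem _ hx
    have hfl : f (sndL x) ∈ S := by rw [hfT x hx]; exact hTS x hx
    simp only
    rw [hG.normDet_graph hfl (hf' _ hl).2.1 (hf' _ hl).2.2, hfT x hx, hσ x (hTS x hx)]
  refine ⟨hG.measurableSet.image_of_continuousOn_injOn sndL.continuous.continuousOn hinj,
    fun h => ?_⟩
  -- Both sides are countably additive over the partition, on the right because `sndL` is injective
  -- on `S` and keeps the images disjoint.
  obtain ⟨t, htm, hdis, hun, ht⟩ := hG.measurableSet.exists_partition_of_locally
    (by intro h; simp) hloc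
  have htS : ∀ i, t i ⊆ S := fun i => hun ▸ subset_iUnion t i
  rw [← hun, image_iUnion, lintegral_iUnion htm hdis, lintegral_iUnion
    (fun i => (htm i).image_of_continuousOn_injOn sndL.continuous.continuousOn
      (hinj.mono (htS i)))]
  · exact tsum_congr fun i => ht i _ subset_rfl (htm i) h
  · intro i j hij
    refine disjoint_left.2 ?_
    rintro _ ⟨x, hx, rfl⟩ ⟨y, hy, hxy⟩
    rw [hinj (htS j hy) (htS i hx) hxy] at hy
    exact disjoint_left.1 (hdis hij) hx hy

end Graph

end IsImplicitGraph

end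

/-! ### Coarea formula for slices by the first block -/

noncomputable section

open EuclideanSpace Matrix Module Set

namespace IsImplicitGraph

variable {P N K : Type*} [Fintype P] [Fintype N] [Fintype K]
  {F : EuclideanSpace ℝ (P ⊕ N) → EuclideanSpace ℝ P}
  {F' : EuclideanSpace ℝ (P ⊕ N) → EuclideanSpace ℝ (P ⊕ N) →L[ℝ] EuclideanSpace ℝ P}
  {J : EuclideanSpace ℝ (P ⊕ N) → Matrix P N ℝ} {S : Set (EuclideanSpace ℝ (P ⊕ N))}

section Coarea

variable [DecidableEq N]

/-- The coordinates of an implicit graph given by the first block and by linear functions of the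
second block. -/
def sliceCoord (Q : Matrix K N ℝ) : EuclideanSpace ℝ (P ⊕ N) →L[ℝ] EuclideanSpace ℝ (P ⊕ K) :=
  glueL.comp (fstL.prod ((LinearMap.toContinuousLinearMap (Matrix.toEuclideanLin Q)).comp sndL))

theorem fstL_sliceCoord (Q : Matrix K N ℝ) (x : EuclideanSpace ℝ (P ⊕ N)) :
    fstL (sliceCoord Q x) = fstL x := fstL_glueL _

theorem ofLp_sndL_sliceCoord (Q : Matrix K N ℝ) (x : EuclideanSpace ℝ (P ⊕ N)) :
    (sndL (sliceCoord Q x)).ofLp = Q *ᵥ (sndL x).ofLp := by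
  rw [sliceCoord, ContinuousLinearMap.comp_apply, sndL_glueL]
  rfl

/-- A tangent vector with vanishing first block has its second block in the kernel of `J x`, where
`Q` is injective; the dimensions agree. -/
theorem bijective_prod_sliceCoord (hG : IsImplicitGraph F F' J S)
    (hcard : Fintype.card P + Fintype.card K = Fintype.card N) {x : EuclideanSpace ℝ (P ⊕ N)}
    (hx : x ∈ S) {Q : Matrix K N ℝ} (hQ : ∀ v, J x *ᵥ v = 0 → Q *ᵥ v = 0 → v = 0) :
    Function.Bijective ((F' x).prod (sliceCoord Q)) := by
  have hinj : Function.Injective ((F' x).prod (sliceCoord Q)) := by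
    refine (injective_iff_map_eq_zero _).2 fun v hv => ?_
    obtain ⟨h1, h2⟩ := Prod.ext_iff.1 hv
    have h2' : sliceCoord Q v = 0 := h2
    have h4 : fstL v = 0 := by rw [← fstL_sliceCoord Q, h2', map_zero]
    have h5 : Q *ᵥ (sndL v).ofLp = 0 := by
      rw [← ofLp_sndL_sliceCoord, h2', map_zero, WithLp.ofLp_zero]
    have h3 := (hG.apply_eq_zero_iff x hx v).1 h1
    rw [h4, WithLp.ofLp_zero] at h3
    have h6 : sndL v = 0 := by
      ext i; exact congrFun (hQ _ h3.symm h5) i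
    rw [← glueL_fstL_sndL v, h6, h4]
    exact map_zero glueL
  refine ⟨hinj, (LinearMap.injective_iff_surjective_of_finrank_eq_finrank
    (f := ((F' x).prod (sliceCoord Q)).toLinearMap) ?_).1 hinj⟩
  simp [finrank_prod, ← hcard]

variable [DecidableEq P] [DecidableEq K]

/-- The second block `M = (C T)` of `f'` is a right inverse of `(J; Q)`. The whole map has matrix
`(JM; M)` and Gram determinant `det (M'(1 + J'J)M)`; along the slice the matrix is `(0; T)` and the
Gram determinant `det T'T`. These are the quantities related by `Matrix.det_gram_right_inverse`. -/
theorem normDet_slice (hG : IsImplicitGraph F F' J S)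
    (hcard : Fintype.card P + Fintype.card K = Fintype.card N) {x : EuclideanSpace ℝ (P ⊕ N)}
    (hx : x ∈ S) {Q : Matrix K N ℝ}
    {f' : EuclideanSpace ℝ (P ⊕ K) →L[ℝ] EuclideanSpace ℝ (P ⊕ N)}
    (h1 : (F' x).comp f' = 0) (h2 : (sliceCoord Q).comp f' = ContinuousLinearMap.id ℝ _) :
    (f'.comp (glueL.comp (ContinuousLinearMap.inr ℝ _ _))).toLinearMap.normDet =
      Real.sqrt (J x * (J x)ᵀ).det / Real.sqrt (J x * (J x)ᵀ + 1).det *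
        f'.toLinearMap.normDet := by
  set M : Matrix N (P ⊕ K) ℝ := Matrix.toEuclideanLin.symm (sndL.comp f').toLinearMap with hM
  have hMv : ∀ v, (sndL (f' v)).ofLp = M *ᵥ v.ofLp := fun v => by
    have : Matrix.toEuclideanLin M v = sndL (f' v) := by
      rw [hM, LinearEquiv.apply_symm_apply]; rfl
    rw [← this]; rfl
  have htop : ∀ v, (fstL (f' v)).ofLp = J x *ᵥ M *ᵥ v.ofLp := fun v => by
    rw [← hMv]
    exact (hG.apply_eq_zero_iff x hx (f' v)).1 (DFunLike.congr_fun h1 v)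
  have hid : ∀ v, sliceCoord Q (f' v) = v := fun v => DFunLike.congr_fun h2 v
  have hinv : fromRows (J x) Q * fromCols M.toCols₁ M.toCols₂ = 1 := by
    rw [fromCols_toCols]
    refine Matrix.mulVec_injective (funext fun v => ?_)
    obtain ⟨w, rfl⟩ : ∃ w : EuclideanSpace ℝ (P ⊕ K), w.ofLp = v := ⟨WithLp.toLp 2 v, rfl⟩
    rw [← mulVec_mulVec, fromRows_mulVec, ← htop, ← hMv, ← ofLp_sndL_sliceCoord,
      ← fstL_sliceCoord Q (f' w), hid, one_mulVec, ← ofLp_eq_sumElim]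
  have hD : f'.toLinearMap.normDet ^ 2 = ((fromRows (J x * M) M)ᵀ * fromRows (J x * M) M).det := by
    refine LinearMap.normDet_sq_eq_det_transpose_mul _ _ fun v => ?_
    rw [fromRows_mulVec, ← mulVec_mulVec, ← htop, ← hMv, ContinuousLinearMap.coe_coe,
      ← ofLp_eq_sumElim]
  have hT : (f'.comp (glueL.comp (ContinuousLinearMap.inr ℝ _ _))).toLinearMap.normDet ^ 2 =
      ((fromRows (0 : Matrix P K ℝ) M.toCols₂)ᵀ * fromRows (0 : Matrix P K ℝ) M.toCols₂).det := by
    refine LinearMap.normDet_sq_eq_det_transpose_mul _ _ fun v => ?_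
    have h3 : sndL (f' (glueL (0, v))) = WithLp.toLp 2 (M.toCols₂ *ᵥ v.ofLp) := by
      ext i
      rw [hMv, ofLp_eq_sumElim, fstL_glueL, sndL_glueL]
      nth_rewrite 1 [← fromCols_toCols M]
      rw [fromCols_mulVec_sumElim, WithLp.ofLp_zero, mulVec_zero, zero_add]
    have h4 : fstL (f' (glueL (0, v))) = 0 := by
      rw [← fstL_sliceCoord Q, hid, fstL_glueL]
    change (f' (glueL (0, v))).ofLp = _
    rw [ofLp_eq_sumElim, h3, h4, fromRows_mulVec, zero_mulVec, WithLp.ofLp_zero]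
  have key := Matrix.det_gram_right_inverse hcard (J x) Q M.toCols₁ M.toCols₂ hinv
  rw [transpose_fromRows, fromCols_mul_fromRows, transpose_zero, Matrix.zero_mul, zero_add] at hT
  rw [transpose_fromRows, fromCols_mul_fromRows, transpose_mul] at hD
  rw [fromCols_toCols, ← hT, Matrix.mul_add, Matrix.add_mul, Matrix.mul_one, add_comm (Mᵀ * M),
    ← Matrix.mul_assoc Mᵀ, Matrix.mul_assoc _ (J x) M, ← hD] at key
  have hpos := Matrix.det_mul_transpose_add_one_pos (J x)
  have ha := LinearMap.normDet_nonneg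
    (f'.comp (glueL.comp (ContinuousLinearMap.inr ℝ _ _))).toLinearMap
  have hb := LinearMap.normDet_nonneg f'.toLinearMap
  rw [div_mul_eq_mul_div, eq_div_iff (Real.sqrt_pos.2 hpos).ne']
  have := congrArg Real.sqrt key
  rw [Real.sqrt_mul (sq_nonneg _), Real.sqrt_mul (sq_nonneg _), Real.sqrt_sq ha,
    Real.sqrt_sq hb] at this
  rw [this, mul_comm]

/-- The factor relating the Hausdorff measure of an implicit graph to the integral of those of its
slices. -/
def sliceDensity (J : Matrix P N ℝ) : ℝ≥0∞ :=
  ENNReal.ofReal (Real.sqrt (J * Jᵀ).det / Real.sqrt (J * Jᵀ + 1).det)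

/-- The coarea formula for the first block of coordinates, locally. -/
theorem exists_nhds_coarea (hG : IsImplicitGraph F F' J S)
    {x₀ : EuclideanSpace ℝ (P ⊕ N)} (hx₀ : x₀ ∈ S) (hrank : (J x₀).rank = Fintype.card P) :
    ∃ V ∈ 𝓝 x₀, ∀ T ⊆ S ∩ V, MeasurableSet T →
      Measurable (fun b => (μHE[Fintype.card N - Fintype.card P] :
        Measure (EuclideanSpace ℝ (P ⊕ N))) (T ∩ {x | fstL x = b})) ∧
      ∫⁻ b, (μHE[Fintype.card N - Fintype.card P] :
        Measure (EuclideanSpace ℝ (P ⊕ N))) (T ∩ {x | fstL x = b}) =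
        ∫⁻ x in T, sliceDensity (J x) ∂(μHE[Fintype.card N] :
          Measure (EuclideanSpace ℝ (P ⊕ N))) := by
  have hle : Fintype.card P ≤ Fintype.card N := by
    rw [← hrank]; exact (J x₀).rank_le_card_width
  set K := Fin (Fintype.card N - Fintype.card P)
  obtain ⟨Q, hQ⟩ : ∃ Q : Matrix K N ℝ, ∀ v, J x₀ *ᵥ v = 0 → Q *ᵥ v = 0 → v = 0 :=
    Matrix.exists_fromRows_injective (J x₀) hrank
  have hcard : Fintype.card P + Fintype.card K = Fintype.card N := by
    simp only [K, Fintype.card_fin]; omega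
  obtain ⟨W, hW, f, -, -, hf, hf'⟩ := exists_local_parametrization hG.hasStrictFDerivAt
    (sliceCoord Q) hx₀ (hG.zero x₀ hx₀) (hG.bijective_prod_sliceCoord hcard hx₀ hQ)
  refine ⟨W, hW, fun T hT hTm => ?_⟩
  have hTS : ∀ x ∈ T, x ∈ S := fun x hx => (hT hx).1
  have hfT : ∀ x ∈ T, f (sliceCoord Q x) = x := fun x hx => hf x (hT hx).2 (hG.zero x (hTS x hx))
  set U := (sliceCoord Q : EuclideanSpace ℝ (P ⊕ N) → EuclideanSpace ℝ (P ⊕ K)) '' T with hU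
  have hd : ∀ y, ∃ f' : EuclideanSpace ℝ (P ⊕ K) →L[ℝ] EuclideanSpace ℝ (P ⊕ N), y ∈ U →
      HasStrictFDerivAt f f' y ∧ (F' (f y)).comp f' = 0 ∧
        (sliceCoord Q).comp f' = ContinuousLinearMap.id ℝ _ := by
    intro y
    by_cases hy : y ∈ U
    · obtain ⟨x, hx, rfl⟩ := hy
      obtain ⟨f', h'⟩ := hf' x ⟨hTS x hx, (hT hx).2⟩ (hG.zero x (hTS x hx))
      exact ⟨f', fun _ => by rwa [hfT x hx]⟩
    · exact ⟨0, fun h => absurd h hy⟩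
  choose f' hf' using hd
  have himage : f '' U = T := by
    rw [hU, image_image]
    exact (image_congr hfT).trans (image_id T)
  have hinjT : InjOn (sliceCoord Q : EuclideanSpace ℝ (P ⊕ N) → EuclideanSpace ℝ (P ⊕ K)) T :=
    fun x hx y hy hxy => by rw [← hfT x hx, ← hfT y hy, hxy]
  have hUm : MeasurableSet U :=
    hTm.image_of_continuousOn_injOn (sliceCoord Q).continuous.continuousOn hinjT
  have hinjU : InjOn f U := by
    rintro _ ⟨x, hx, rfl⟩ _ ⟨y, hy, rfl⟩ hxy
    rw [hfT x hx, hfT y hy] at hxy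
    rw [hxy]
  have hfU : ∀ y ∈ U, f y ∈ S := by
    rintro _ ⟨x, hx, rfl⟩
    rw [hfT x hx]; exact hTS x hx
  have hinj' : ∀ y ∈ U, Function.Injective (f' y) := fun y hy =>
    Function.LeftInverse.injective (g := sliceCoord Q) fun v => DFunLike.congr_fun (hf' y hy).2.2 v
  have harea := lintegral_hausdorff_image_eq (f := f) (f' := f') hUm hinjU
    (fun y hy => (hf' y hy).1) hinj' fun x => sliceDensity (J x)
  rw [himage, finrank_euclideanSpace, Fintype.card_sum, hcard] at harea
  set A := fun y => (f' y).comp (glueL.comp (ContinuousLinearMap.inr ℝ (EuclideanSpace ℝ P)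
    (EuclideanSpace ℝ K))) with hA
  -- The volume factor of the slice parametrization, extended by zero off `U` so that Tonelli's
  -- theorem applies on the full product space.
  set φ : EuclideanSpace ℝ (P ⊕ K) → ℝ≥0∞ :=
    U.indicator fun y => ENNReal.ofReal (A y).toLinearMap.normDet with hφ
  have hAc : ContinuousOn (fun y => ENNReal.ofReal (A y).toLinearMap.normDet) U := by
    refine ENNReal.continuous_ofReal.comp_continuousOn
      (ContinuousLinearMap.continuous_normDet.comp_continuousOn ?_)
    exact (continuousOn_of_hasStrictFDerivAt fun y hy => (hf' y hy).1).clm_comp continuousOn_const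
  have hφm : Measurable φ := by
    classical
    rw [hφ, ← piecewise_eq_indicator]
    exact hAc.measurable_piecewise continuousOn_const hUm
  have hright : ∫⁻ x in T, sliceDensity (J x) ∂(μHE[Fintype.card N] :
      Measure (EuclideanSpace ℝ (P ⊕ N))) = ∫⁻ y, φ y := by
    rw [harea, hφ, lintegral_indicator hUm]
    refine setLIntegral_congr_fun hUm fun y hy => ?_
    simp only [hA]
    rw [hG.normDet_slice hcard (hfU y hy) (hf' y hy).2.1 (hf' y hy).2.2,
      ENNReal.ofReal_mul (by positivity), mul_comm, sliceDensity]
  have hleft : ∀ b, (μHE[Fintype.card N - Fintype.card P] :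
        Measure (EuclideanSpace ℝ (P ⊕ N))) (T ∩ {x | fstL x = b}) =
      ∫⁻ t : EuclideanSpace ℝ K, φ (glueL (b, t)) := by
    intro b
    -- The slice at `b` is parametrized by `f ∘ c`, since the first block of `sliceCoord Q` is that
    -- of the point itself. The area formula is then applied a second time.
    set c : EuclideanSpace ℝ K → EuclideanSpace ℝ (P ⊕ K) := fun t => glueL (b, t) with hc
    have hcd : ∀ t, HasStrictFDerivAt c (glueL.comp (ContinuousLinearMap.inr ℝ _ _)) t := fun t =>
      glueL.hasStrictFDerivAt.comp t ((hasStrictFDerivAt_const b t).prodMk (hasStrictFDerivAt_id t))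
    have hcinj : Function.Injective c := fun t t' h => (Prod.ext_iff.1 (glueL_injective h)).2
    have hcm : Measurable c := (continuous_iff_continuousAt.2 fun t =>
      (hcd t).continuousAt).measurable
    have hslice : (f ∘ c) '' (c ⁻¹' U) = T ∩ {x | fstL x = b} := by
      rw [image_comp, image_preimage_eq_inter_range]
      ext x
      constructor
      · rintro ⟨_, ⟨⟨x, hx, rfl⟩, ⟨t, ht⟩⟩, rfl⟩
        rw [hfT x hx]
        refine ⟨hx, ?_⟩
        rw [mem_ofPred_eq, ← fstL_sliceCoord Q, ← ht, hc, fstL_glueL]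
      · rintro ⟨hx, hb⟩
        refine ⟨sliceCoord Q x, ⟨mem_image_of_mem _ hx, sndL (sliceCoord Q x), ?_⟩, hfT x hx⟩
        rw [mem_ofPred_eq] at hb
        rw [hc, ← hb, ← fstL_sliceCoord Q x]
        exact glueL_fstL_sndL _
    have := lintegral_hausdorff_image_eq (f := f ∘ c) (f' := fun t => A (c t)) (hcm hUm)
      (fun t ht t' ht' h => hcinj (hinjU ht ht' h))
      (fun t ht => (hf' _ ht).1.comp t (hcd t))
      (fun t ht => (hinj' _ ht).comp (glueL_injective.comp (Prod.mk_right_injective _)))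
      fun _ => 1
    rw [hslice, setLIntegral_one, finrank_euclideanSpace, Fintype.card_fin] at this
    rw [this, ← lintegral_indicator (hcm hUm)]
    refine lintegral_congr fun t => ?_
    simp only [mul_one]
    rfl
  have hjm : Measurable fun z : EuclideanSpace ℝ P × EuclideanSpace ℝ K => φ (glueL z) :=
    hφm.comp glueL.continuous.measurable
  refine ⟨?_, ?_⟩
  · simp_rw [hleft]
    exact hjm.lintegral_prod_right'
  · simp_rw [hleft]
    rw [hright, ← lintegral_glueL, Measure.volume_eq_prod, lintegral_prod _ hjm.aemeasurable]

/-- The coarea formula for the first block of coordinates. -/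
theorem bind_slices_eq (hG : IsImplicitGraph F F' J S)
    (hrank : ∀ x ∈ S, (J x).rank = Fintype.card P) :
    ((volume : Measure (EuclideanSpace ℝ P)).bind fun b =>
      (μHE[Fintype.card N - Fintype.card P] : Measure (EuclideanSpace ℝ (P ⊕ N))).restrict
        (S ∩ {x | fstL x = b})) =
      ((μHE[Fintype.card N] : Measure (EuclideanSpace ℝ (P ⊕ N))).restrict S).withDensity
        fun x => sliceDensity (J x) := by
  obtain ⟨t, htm, hdis, hun, ht⟩ := hG.measurableSet.exists_partition_of_locally
    (by simp) fun x hx => hG.exists_nhds_coarea hx (hrank x hx)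
  have hfib : ∀ b, MeasurableSet {x : EuclideanSpace ℝ (P ⊕ N) | fstL x = b} := fun b =>
    fstL.continuous.measurable (measurableSet_singleton b)
  have happ : ∀ A : Set (EuclideanSpace ℝ (P ⊕ N)), MeasurableSet A → ∀ b,
      (μHE[Fintype.card N - Fintype.card P] : Measure (EuclideanSpace ℝ (P ⊕ N))).restrict
        (S ∩ {x | fstL x = b}) A = ∑' i,
      (μHE[Fintype.card N - Fintype.card P] : Measure (EuclideanSpace ℝ (P ⊕ N)))
        ((A ∩ t i) ∩ {x | fstL x = b}) := by
    intro A hA b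
    rw [Measure.restrict_apply hA, ← inter_assoc, ← hun, inter_iUnion, iUnion_inter,
      measure_iUnion]
    · exact fun i j hij => (hdis hij).mono (inter_subset_left.trans inter_subset_right)
        (inter_subset_left.trans inter_subset_right)
    · exact fun i => (hA.inter (htm i)).inter (hfib b)
  have hA : ∀ A : Set (EuclideanSpace ℝ (P ⊕ N)), MeasurableSet A → ∀ i,
      _ ∧ _ := fun A hA i => ht i (A ∩ t i) inter_subset_right (hA.inter (htm i))
  -- `Measure.bind` is the integral of the slice measures only for an a.e. measurable family;
  -- measurability is inherited from the local pieces by summation.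
  have hmeas : Measurable fun b =>
      (μHE[Fintype.card N - Fintype.card P] : Measure (EuclideanSpace ℝ (P ⊕ N))).restrict
        (S ∩ {x | fstL x = b}) := by
    refine Measure.measurable_of_measurable_coe _ fun A hAm => ?_
    simp_rw [happ A hAm]
    exact Measurable.tsum fun i => (hA A hAm i).1
  ext A hAm
  rw [Measure.bind_apply hAm hmeas.aemeasurable, withDensity_apply _ hAm,
    Measure.restrict_restrict hAm, ← hun, inter_iUnion,
    lintegral_iUnion (fun i => hAm.inter (htm i))
      fun i j hij => (hdis hij).mono inter_subset_right inter_subset_right]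
  rw [hun]
  simp_rw [happ A hAm]
  rw [lintegral_tsum fun i => (hA A hAm i).1.aemeasurable]
  exact tsum_congr fun i => (hA A hAm i).2

end Coarea

end IsImplicitGraph

end

/-! ### The parameter space as an implicit graph -/

noncomputable section

open EuclideanSpace Matrix Module Set

theorem jacobianMatrix_mulVec {m n : Type*} [Fintype m] [Fintype n] [DecidableEq n]
    (F : EuclideanSpace ℝ n → EuclideanSpace ℝ m) (x v : EuclideanSpace ℝ n) :
    jacobianMatrix F x *ᵥ v.ofLp = (fderiv ℝ F x v).ofLp := by
  ext r
  conv_rhs => rw [← (EuclideanSpace.basisFun n ℝ).sum_repr v]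
  simp [jacobianMatrix, mulVec, dotProduct, mul_comm]

namespace MomentModel

variable {p d Jt k : ℕ} (M : MomentModel p d k)

/-- The moment `∑_j θ_j g(s_j, β)`. -/
def moment (x : FullParam p d Jt k) : EuclideanSpace ℝ (Fin p) :=
  ∑ c, x.free.theta c • M.g (M.point x.free c) x.beta + x.free.thetaLast • M.g M.sLast x.beta

/-- The Jacobian matrix `(J_{θ*}, J_{S̃})`. -/
def slope (x : FullParam p d Jt k) : Matrix (Fin p) ((Fin Jt ⊕ Fin k) ⊕ (Fin Jt × Fin d)) ℝ :=
  fromCols (M.JTheta x) (M.JS x)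

theorem gram_eq (x : FullParam p d Jt k) : M.gram x = M.slope x * (M.slope x)ᵀ := by
  rw [slope, transpose_fromCols, fromCols_mul_fromRows, gram]

variable (p d Jt k) in
/-- The probability `θ_c` as a linear function of the parameter. -/
def thetaL (c : Fin Jt ⊕ Fin k) : FullParam p d Jt k →L[ℝ] ℝ :=
  EuclideanSpace.proj (Sum.inr (Sum.inl c))

variable (p d Jt k) in
/-- The unobserved support point `s_j` as a linear function of the parameter. -/
def missingL (j : Fin Jt) : FullParam p d Jt k →L[ℝ] EuclideanSpace ℝ (Fin d) :=
  (PiLp.continuousLinearEquiv 2 ℝ (fun _ : Fin d => ℝ)).symm.toContinuousLinearMap.comp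
    (ContinuousLinearMap.pi fun i => EuclideanSpace.proj (Sum.inr (Sum.inr (j, i))))

variable (p d Jt k) in
/-- The linear part of the probability of the last support point. -/
def thetaLastL : FullParam p d Jt k →L[ℝ] ℝ := -∑ c, thetaL p d Jt k c

theorem thetaL_apply (c : Fin Jt ⊕ Fin k) (x : FullParam p d Jt k) :
    thetaL p d Jt k c x = x.free.theta c := rfl

theorem missingL_apply (j : Fin Jt) (x : FullParam p d Jt k) :
    missingL p d Jt k j x = x.missing j := rfl

theorem fstL_eq_beta (x : FullParam p d Jt k) : fstL x = x.beta := rfl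

theorem sndL_eq_free (x : FullParam p d Jt k) : sndL x = x.free := rfl

theorem thetaLast_eq (x : FullParam p d Jt k) :
    x.free.thetaLast = 1 + thetaLastL p d Jt k x := by
  simp [thetaLastL, FreeParam.thetaLast, thetaL_apply, sub_eq_add_neg]

variable {M}

theorem contDiffAt_g (hg_missing : ∀ x ∈ M.paramSpace Jt, ∀ j : Fin Jt,
      ContDiffAt ℝ 1
        (fun z : EuclideanSpace ℝ (Fin d) × EuclideanSpace ℝ (Fin p) => M.g z.1 z.2)
        (x.missing j, x.beta))
    (hg_obs : ∀ x ∈ M.paramSpace Jt, ∀ i : Fin (k + 1), ContDiffAt ℝ 1 (M.g (M.s i)) x.beta)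
    {x : FullParam p d Jt k} (hx : x ∈ M.paramSpace Jt) (c : Fin Jt ⊕ Fin k) :
    ContDiffAt ℝ 1 (fun x : FullParam p d Jt k => M.g (M.point x.free c) x.beta) x := by
  rcases c with j | i
  · exact ContDiffAt.comp (f := fun x => (missingL p d Jt k j x, fstL x)) x (hg_missing x hx j)
      ((missingL p d Jt k j).contDiff.prodMk fstL.contDiff).contDiffAt
  · exact ContDiffAt.comp (f := fun x => fstL x) x (hg_obs x hx i.castSucc)
      (fstL : FullParam p d Jt k →L[ℝ] _).contDiff.contDiffAt

theorem contDiffAt_moment (hg_missing : ∀ x ∈ M.paramSpace Jt, ∀ j : Fin Jt,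
      ContDiffAt ℝ 1
        (fun z : EuclideanSpace ℝ (Fin d) × EuclideanSpace ℝ (Fin p) => M.g z.1 z.2)
        (x.missing j, x.beta))
    (hg_obs : ∀ x ∈ M.paramSpace Jt, ∀ i : Fin (k + 1), ContDiffAt ℝ 1 (M.g (M.s i)) x.beta)
    {x : FullParam p d Jt k} (hx : x ∈ M.paramSpace Jt) :
    ContDiffAt ℝ 1 (M.moment (Jt := Jt)) x := by
  refine ContDiffAt.add (ContDiffAt.sum fun c _ => ?_) ?_
  · exact (thetaL p d Jt k c).contDiff.contDiffAt.smul (contDiffAt_g hg_missing hg_obs hx c)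
  · simp_rw [thetaLast_eq]
    exact (contDiffAt_const.add (thetaLastL p d Jt k).contDiff.contDiffAt).smul
      (ContDiffAt.comp (f := fun x => fstL x) x (hg_obs x hx (Fin.last k))
        (fstL : FullParam p d Jt k →L[ℝ] _).contDiff.contDiffAt)

/-- Joint differentiability in `(s, β)` splits the total derivative into partial ones. The `s` part
is absent at observed points, which are constants. -/
theorem exists_hasFDerivAt_g (hg_missing : ∀ x ∈ M.paramSpace Jt, ∀ j : Fin Jt,
      ContDiffAt ℝ 1
        (fun z : EuclideanSpace ℝ (Fin d) × EuclideanSpace ℝ (Fin p) => M.g z.1 z.2)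
        (x.missing j, x.beta))
    (hg_obs : ∀ x ∈ M.paramSpace Jt, ∀ i : Fin (k + 1), ContDiffAt ℝ 1 (M.g (M.s i)) x.beta)
    {x : FullParam p d Jt k} (hx : x ∈ M.paramSpace Jt) (c : Fin Jt ⊕ Fin k) :
    ∃ D : FullParam p d Jt k →L[ℝ] EuclideanSpace ℝ (Fin p),
      HasFDerivAt (fun x : FullParam p d Jt k => M.g (M.point x.free c) x.beta) D x ∧
      ∀ v, D v = fderiv ℝ (M.g (M.point x.free c)) x.beta v.beta +
        Sum.elim (fun j => fderiv ℝ (fun s => M.g s x.beta) (x.missing j) (v.missing j))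
          (fun _ => 0) c := by
  rcases c with j | i
  · set G := fun z : EuclideanSpace ℝ (Fin d) × EuclideanSpace ℝ (Fin p) => M.g z.1 z.2
    have hG : HasFDerivAt G (fderiv ℝ G (x.missing j, x.beta)) (x.missing j, x.beta) :=
      ((hg_missing x hx j).differentiableAt one_ne_zero).hasFDerivAt
    refine ⟨(fderiv ℝ G (x.missing j, x.beta)).comp ((missingL p d Jt k j).prod fstL), ?_, ?_⟩
    · exact HasFDerivAt.comp (f := fun x => (missingL p d Jt k j x, fstL x)) x hG
        ((missingL p d Jt k j).hasFDerivAt.prodMk fstL.hasFDerivAt)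
    · intro v
      have h1 : HasFDerivAt (M.g (x.missing j)) ((fderiv ℝ G (x.missing j, x.beta)).comp
          (ContinuousLinearMap.inr ℝ _ _)) x.beta :=
        HasFDerivAt.comp (f := fun b => (x.missing j, b)) x.beta hG
          ((hasFDerivAt_const _ _).prodMk (hasFDerivAt_id _))
      have h2 : HasFDerivAt (fun s => M.g s x.beta) ((fderiv ℝ G (x.missing j, x.beta)).comp
          (ContinuousLinearMap.inl ℝ _ _)) (x.missing j) :=
        HasFDerivAt.comp (f := fun s => (s, x.beta)) (x.missing j) hG
          ((hasFDerivAt_id _).prodMk (hasFDerivAt_const _ _))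
      change _ = fderiv ℝ (M.g (x.missing j)) x.beta v.beta +
        fderiv ℝ (fun s => M.g s x.beta) (x.missing j) (v.missing j)
      rw [h1.fderiv, h2.fderiv]
      simp only [ContinuousLinearMap.comp_apply, ContinuousLinearMap.inr_apply,
        ContinuousLinearMap.inl_apply]
      rw [← map_add]
      simp [missingL_apply, fstL_eq_beta]
  · have hG : HasFDerivAt (M.g (M.s i.castSucc)) (fderiv ℝ (M.g (M.s i.castSucc)) x.beta) x.beta :=
      ((hg_obs x hx i.castSucc).differentiableAt one_ne_zero).hasFDerivAt
    refine ⟨(fderiv ℝ (M.g (M.s i.castSucc)) x.beta).comp fstL,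
      HasFDerivAt.comp (f := fun x => fstL x) x hG fstL.hasFDerivAt, fun v => ?_⟩
    simp [fstL_eq_beta, point]

/-- By the product rule the variations of `β`, `θ*` and `S̃` enter through `A`, `H` and `M̃`. The
dependence of the last probability on `θ*` supplies the subtracted `g_{J*}` in `H`. -/
theorem ofLp_fderiv_moment (hg_missing : ∀ x ∈ M.paramSpace Jt, ∀ j : Fin Jt,
      ContDiffAt ℝ 1
        (fun z : EuclideanSpace ℝ (Fin d) × EuclideanSpace ℝ (Fin p) => M.g z.1 z.2)
        (x.missing j, x.beta))
    (hg_obs : ∀ x ∈ M.paramSpace Jt, ∀ i : Fin (k + 1), ContDiffAt ℝ 1 (M.g (M.s i)) x.beta)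
    {x : FullParam p d Jt k} (hx : x ∈ M.paramSpace Jt) (v : FullParam p d Jt k) :
    (fderiv ℝ (M.moment (Jt := Jt)) x v).ofLp =
      M.meanJac x *ᵥ v.beta.ofLp + fromCols (M.H x) (M.Mtilde x) *ᵥ v.free.ofLp := by
  choose D hD hDv using exists_hasFDerivAt_g hg_missing hg_obs hx
  have hlast : HasFDerivAt (fun x : FullParam p d Jt k => M.g M.sLast x.beta)
      ((fderiv ℝ (M.g M.sLast) x.beta).comp fstL) x :=
    HasFDerivAt.comp (f := fun x => fstL x) x
      (((hg_obs x hx (Fin.last k)).differentiableAt one_ne_zero).hasFDerivAt) fstL.hasFDerivAt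
  have hθlast : HasFDerivAt (fun x : FullParam p d Jt k => x.free.thetaLast)
      (thetaLastL p d Jt k) x := by
    simp_rw [thetaLast_eq]
    exact (thetaLastL p d Jt k).hasFDerivAt.const_add 1
  have hder := (HasFDerivAt.fun_sum fun c (_ : c ∈ Finset.univ) =>
    (thetaL p d Jt k c).hasFDerivAt.smul (hD c)).add (hθlast.smul hlast)
  have hF : fderiv ℝ (M.moment (Jt := Jt)) x = _ := HasFDerivAt.fderiv hder
  have hg : ∀ (s : EuclideanSpace ℝ (Fin d)) (r : Fin p),
      (fderiv ℝ (M.g s) x.beta v.beta) r = (jacobianMatrix (M.g s) x.beta *ᵥ v.beta.ofLp) r :=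
    fun s r => by rw [jacobianMatrix_mulVec]
  have hs : ∀ (j : Fin Jt) (r : Fin p),
      (fderiv ℝ (fun s => M.g s x.beta) (x.missing j) (v.missing j)) r =
        (jacobianMatrix (fun s => M.g s x.beta) (x.missing j) *ᵥ (v.missing j).ofLp) r :=
    fun j r => by rw [jacobianMatrix_mulVec]
  have hMt : ∀ r, (M.Mtilde x *ᵥ (v.free.ofLp ∘ Sum.inr)) r = ∑ j, x.free.theta (Sum.inl j) *
      (jacobianMatrix (fun s => M.g s x.beta) (x.missing j) *ᵥ (v.missing j).ofLp) r := fun r => by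
    simp only [mulVec, dotProduct, Mtilde, Fintype.sum_prod_type, Finset.mul_sum, of_apply,
      mul_assoc]
    rfl
  have hH : ∀ r, (M.H x *ᵥ (v.free.ofLp ∘ Sum.inl)) r =
      ∑ c, v.free.theta c * M.g (M.point x.free c) x.beta r
        - (∑ c, v.free.theta c) * M.g M.sLast x.beta r := fun r => by
    simp only [mulVec, dotProduct, H, of_apply, Finset.sum_mul, ← Finset.sum_sub_distrib]
    refine Finset.sum_congr rfl fun c _ => ?_
    change _ * v.free.theta c = _
    ring
  have hA : ∀ r, (M.meanJac x *ᵥ v.beta.ofLp) r =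
      ∑ c, x.free.theta c * (jacobianMatrix (M.g (M.point x.free c)) x.beta *ᵥ v.beta.ofLp) r
        + x.free.thetaLast * (jacobianMatrix (M.g M.sLast) x.beta *ᵥ v.beta.ofLp) r := fun r => by
    simp only [meanJac, add_mulVec, Matrix.sum_mulVec, smul_mulVec, Pi.add_apply,
      Finset.sum_apply, Pi.smul_apply, smul_eq_mul]
  ext r
  rw [hF, fromCols_mulVec, Pi.add_apply, Pi.add_apply, hA, hH, hMt]
  simp only [_root_.add_apply, _root_.sum_apply,
    _root_.smul_apply, ContinuousLinearMap.smulRight_apply, thetaL_apply, hDv,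
    ContinuousLinearMap.comp_apply, fstL_eq_beta, PiLp.add_apply, PiLp.smul_apply, smul_eq_mul,
    WithLp.ofLp_sum, Finset.sum_apply, hg, Finset.sum_add_distrib, mul_add, thetaLastL,
    _root_.neg_apply, Fintype.sum_sum_type, Sum.elim_inl, Sum.elim_inr, hs,
    PiLp.zero_apply, mul_zero, Finset.sum_const_zero]
  ring

/-- Multiplication by `A⁻¹` turns the linearized moment condition into the graph equation with slope
`-A⁻¹ (H, M̃)`. -/
theorem isImplicitGraph (hB : MeasurableSet M.betaSet)
    (hg_missing : ∀ x ∈ M.paramSpace Jt, ∀ j : Fin Jt,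
      ContDiffAt ℝ 1
        (fun z : EuclideanSpace ℝ (Fin d) × EuclideanSpace ℝ (Fin p) => M.g z.1 z.2)
        (x.missing j, x.beta))
    (hg_obs : ∀ x ∈ M.paramSpace Jt, ∀ i : Fin (k + 1), ContDiffAt ℝ 1 (M.g (M.s i)) x.beta)
    (hdet : ∀ x ∈ M.paramSpace Jt, IsUnit (M.meanJac x).det) :
    IsImplicitGraph (M.moment (Jt := Jt)) (fderiv ℝ (M.moment (Jt := Jt))) M.slope
      (M.paramSpace Jt) where
  measurableSet := by
    -- `g` may be irregular away from `Θ`, so the zero set of the moment need not be Borel. Its part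
    -- inside this open set of continuity is, and it contains `Θ` because being `C^1` at a point
    -- gives continuity nearby.
    set O := interior {x : FullParam p d Jt k | ContinuousAt M.moment x} with hO
    have hcont : ContinuousOn (M.moment (Jt := Jt)) O := fun x hx =>
      ContinuousAt.continuousWithinAt (interior_subset hx)
    have hsub : M.paramSpace Jt ⊆ O := fun x hx => by
      rw [hO, mem_interior_iff_mem_nhds]
      exact ((contDiffAt_moment hg_missing hg_obs hx).eventually (by simp)).mono
        fun y hy => hy.continuousAt
    have hz : MeasurableSet (O ∩ {x | M.moment x = 0}) := by
      have : O ∩ {x | M.moment x = 0} = O \ (O ∩ M.moment ⁻¹' {0}ᶜ) := by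
        ext x; by_cases hx : x ∈ O <;> simp [hx]
      rw [this]
      exact isOpen_interior.measurableSet.diff
        (hcont.isOpen_inter_preimage isOpen_interior isOpen_compl_singleton).measurableSet
    have hθ : Continuous fun x : FullParam p d Jt k => x.free.thetaLast := by
      simp_rw [thetaLast_eq]
      exact continuous_const.add (thetaLastL p d Jt k).continuous
    have heq : M.paramSpace Jt = (fstL ⁻¹' M.betaSet ∩
        ((⋂ c, {x : FullParam p d Jt k | 0 < thetaL p d Jt k c x}) ∩
          {x : FullParam p d Jt k | 0 < x.free.thetaLast})) ∩ (O ∩ {x | M.moment x = 0}) := by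
      ext x
      constructor
      · intro hx
        exact ⟨⟨hx.1, mem_iInter.2 hx.2.1, hx.2.2.1⟩, hsub hx, hx.2.2.2⟩
      · rintro ⟨⟨h1, h2, h3⟩, -, h4⟩
        exact ⟨h1, mem_iInter.1 h2, h3, h4⟩
    rw [heq]
    refine ((fstL.continuous.measurable hB).inter ((MeasurableSet.iInter fun c => ?_).inter ?_)).inter
      hz
    · exact (isOpen_lt continuous_const (thetaL p d Jt k c).continuous).measurableSet
    · exact (isOpen_lt continuous_const hθ).measurableSet
  zero := fun x hx => hx.2.2.2
  hasStrictFDerivAt := fun x hx =>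
    (contDiffAt_moment hg_missing hg_obs hx).hasStrictFDerivAt one_ne_zero
  apply_eq_zero_iff := fun x hx v => by
    have hu := hdet x hx
    have hslope : M.slope x = -((M.meanJac x)⁻¹ * fromCols (M.H x) (M.Mtilde x)) := by
      rw [slope, mul_fromCols, fromCols_neg]; rfl
    have h0 : fderiv ℝ M.moment x v = 0 ↔ (fderiv ℝ M.moment x v).ofLp = 0 :=
      (WithLp.ofLp_eq_zero 2).symm
    rw [h0, ofLp_fderiv_moment hg_missing hg_obs hx, fstL_eq_beta, sndL_eq_free, hslope,
      neg_mulVec, ← mulVec_mulVec]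
    set w := fromCols (M.H x) (M.Mtilde x) *ᵥ (FullParam.free v).ofLp
    constructor
    · intro h
      have := congrArg ((M.meanJac x)⁻¹ *ᵥ ·) (eq_neg_of_add_eq_zero_left h)
      simpa only [mulVec_mulVec, nonsing_inv_mul _ hu, one_mulVec, mulVec_neg] using this
    · intro h
      rw [h, mulVec_neg, mulVec_mulVec, mul_nonsing_inv _ hu, one_mulVec, neg_add_cancel]

end MomentModel

end

/-! ### Product densities and conditional densities -/

noncomputable section

open Set

theorem MeasureTheory.lintegral_fin_nat_prod_eq_prod {n : ℕ} {E : Type*} [MeasurableSpace E]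
    {μ : Measure E} [SigmaFinite μ] {f : Fin n → E → ℝ≥0∞} (hf : ∀ i, Measurable (f i)) :
    ∫⁻ x : Fin n → E, ∏ i, f i (x i) ∂(Measure.pi fun _ => μ) = ∏ i, ∫⁻ x, f i x ∂μ := by
  induction n with
  | zero => simp
  | succ n ih =>
    have h1 : Measurable fun x : Fin n → E => ∏ i : Fin n, f i.succ (x i) :=
      Finset.measurable_prod _ fun i _ => (hf i.succ).comp (measurable_pi_apply i)
    have h2 := (measurePreserving_piFinSuccAbove (fun _ : Fin (n + 1) => μ) 0).lintegral_comp_emb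
      (MeasurableEquiv.measurableEmbedding _) fun z => f 0 z.1 * ∏ i : Fin n, f i.succ (z.2 i)
    rw [Fin.prod_univ_succ, ← ih fun i => hf i.succ,
      ← lintegral_prod_mul (hf 0).aemeasurable h1.aemeasurable]
    refine Eq.trans ?_ h2
    refine lintegral_congr fun x => ?_
    rw [Fin.prod_univ_succ]
    rfl

/-- Both sides agree on boxes by Tonelli's theorem. Sigma-finiteness is asked per index: with no
unobserved points, nothing is known about `f`, and the condition is then vacuous. -/
theorem MeasureTheory.Measure.pi_withDensity {n : ℕ} {E : Type*} [MeasurableSpace E]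
    {μ : Measure E} [SigmaFinite μ] {f : E → ℝ≥0∞} (hf : Measurable f)
    (hσ : Fin n → SigmaFinite (μ.withDensity f)) :
    Measure.pi (fun _ : Fin n => μ.withDensity f) =
      (Measure.pi fun _ : Fin n => μ).withDensity fun x => ∏ i, f (x i) := by
  refine @Measure.pi_eq _ _ _ _ (fun _ : Fin n => μ.withDensity f) hσ _ fun s hs => ?_
  rw [withDensity_apply _ (MeasurableSet.univ_pi hs), ← lintegral_indicator
    (MeasurableSet.univ_pi hs)]
  simp_rw [fun i => withDensity_apply (μ := μ) f (hs i), ← lintegral_indicator (hs _)]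
  rw [← lintegral_fin_nat_prod_eq_prod fun i => hf.indicator (hs i)]
  refine lintegral_congr fun x => ?_
  by_cases hx : x ∈ pi univ s
  · rw [indicator_of_mem hx]
    exact Finset.prod_congr rfl fun i _ => (indicator_of_mem (hx i (mem_univ i)) _).symm
  · rw [indicator_of_notMem hx]
    simp only [mem_univ_pi, not_forall] at hx
    obtain ⟨i, hi⟩ := hx
    exact (Finset.prod_eq_zero (Finset.mem_univ i) (indicator_of_notMem hi _)).symm

/-- The marginal density of the conditioning statistic times the conditional density is the joint
density. -/
theorem IsCondDensity.eq_withDensity {E Y : Type*} [MeasurableSpace E] [StandardBorelSpace E]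
    [Nonempty E] [MeasureSpace Y] {P : Measure E} [IsFiniteMeasure P] {π : E → Y} {ν : Measure E}
    {q : E → ℝ≥0∞} (h : IsCondDensity P π ν q) (hq : Measurable q) (hπ : Measurable π)
    {φ : Y → ℝ≥0∞} (hφ : Measurable φ) (hP : P.map π = volume.withDensity φ) :
    P = ν.withDensity fun x => φ (π x) * q x := by
  obtain ⟨κ, hfib, rfl, hcond⟩ := h
  ext A hA
  have hκq : Measurable fun y => ∫⁻ x in A, q x ∂(κ y) := by
    simp_rw [← lintegral_indicator hA]
    exact (Measure.measurable_lintegral (hq.indicator hA)).comp κ.measurable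
  have hφq : Measurable fun x => φ (π x) * q x := (hφ.comp hπ).mul hq
  -- Law of total probability for the regular conditional distribution of the identity given `π`.
  have hPA : P A = ∫⁻ y, condDistrib id π P y A ∂(P.map π) := by
    have h1 := condDistrib_comp_map (μ := P) hπ.aemeasurable aemeasurable_id
    rw [Measure.map_id] at h1
    conv_lhs => rw [← h1]
    exact Measure.bind_apply hA (Kernel.aemeasurable _)
  rw [hPA, withDensity_apply _ hA, ← lintegral_indicator hA,
    Measure.lintegral_bind (Kernel.aemeasurable _) (hφq.indicator hA).aemeasurable]
  calc _ = ∫⁻ y, ∫⁻ x in A, q x ∂(κ y) ∂(P.map π) := by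
        refine lintegral_congr_ae ?_
        filter_upwards [hcond] with y hy
        rw [hy, withDensity_apply _ hA]
    _ = ∫⁻ y, φ y * ∫⁻ x in A, q x ∂(κ y) := by
        rw [hP, lintegral_withDensity_eq_lintegral_mul _ hφ hκq]
        rfl
    _ = _ := by
        -- Since `κ y` is carried by the fibre `π = y`, the constant `φ y` may be moved inside as `φ
        -- (π x)`.
        refine lintegral_congr_ae ?_
        filter_upwards [hfib] with y hy
        rw [lintegral_indicator hA, ← lintegral_const_mul _ hq]
        refine lintegral_congr_ae (ae_restrict_of_ae ?_)
        filter_upwards [hy] with x hx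
        rw [hx]

namespace MomentModel

variable {p d Jt k : ℕ}

theorem measurable_beta : Measurable (FullParam.beta : FullParam p d Jt k → _) :=
  EuclideanSpace.fstL.continuous.measurable

theorem measurable_missing_apply (j : Fin Jt) :
    Measurable fun x : FullParam p d Jt k => x.missing j :=
  (missingL p d Jt k j).continuous.measurable

theorem measurable_missing : Measurable (FullParam.missing : FullParam p d Jt k → _) :=
  measurable_pi_lambda _ measurable_missing_apply

theorem MissingIID.map_missing {P : Measure (FullParam p d Jt k)} [IsProbabilityMeasure P]
    {fS : EuclideanSpace ℝ (Fin d) → ℝ≥0∞} (h : MissingIID P fS) (hfS : Measurable fS) :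
    P.map FullParam.missing = volume.withDensity fun s => ∏ j, fS (s j) := by
  have h1 := (iIndepFun_iff_map_fun_eq_pi_map
    fun j => (measurable_missing_apply j).aemeasurable).1 h.1
  have h2 : ∀ j : Fin Jt, P.map (fun x => x.missing j) = volume.withDensity fS := h.2
  simp_rw [h2] at h1
  have : ∀ _ : Fin Jt, SigmaFinite
      ((volume : Measure (EuclideanSpace ℝ (Fin d))).withDensity fS) := fun j => by
    rw [← h2 j]
    have := Measure.isProbabilityMeasure_map (μ := P) (measurable_missing_apply j).aemeasurable
    infer_instance
  rw [Measure.pi_withDensity hfS this] at h1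
  exact h1

theorem eq_withDensity_of_condDensity_missing {M : MomentModel p d k}
    {fS : EuclideanSpace ℝ (Fin d) → ℝ≥0∞} (hfS : Measurable fS)
    (P : Measure (FullParam p d Jt k)) [IsProbabilityMeasure P]
    (q : FullParam p d Jt k → ℝ≥0∞) (hq : Measurable q) (hiid : MissingIID P fS)
    (hcond : IsCondDensity P FullParam.missing (M.hausdorff Jt) q) :
    P = (M.hausdorff Jt).withDensity fun x => (∏ j, fS (x.missing j)) * q x :=
  hcond.eq_withDensity (φ := fun s => ∏ j, fS (s j)) hq measurable_missing
    (Finset.measurable_prod _ fun j _ => hfS.comp (measurable_pi_apply j)) (hiid.map_missing hfS)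

/-- Independence makes the law of `(β, S̃)` a product, so its density is the product of the two
marginal densities. -/
theorem eq_withDensity_of_condDensity_beta_missing {M : MomentModel p d k}
    {fS : EuclideanSpace ℝ (Fin d) → ℝ≥0∞} (hfS : Measurable fS)
    (P : Measure (FullParam p d Jt k)) [IsProbabilityMeasure P]
    (fβ : EuclideanSpace ℝ (Fin p) → ℝ≥0∞) (q : FullParam p d Jt k → ℝ≥0∞)
    (hfβ : Measurable fβ) (hq : Measurable q) (hβ : P.map FullParam.beta = volume.withDensity fβ)
    (hiid : MissingIID P fS) (hind : IndepFun FullParam.beta FullParam.missing P)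
    (hcond : IsCondDensity P (fun x => (x.beta, x.missing)) (M.slicedHausdorff Jt) q) :
    P = (M.slicedHausdorff Jt).withDensity
      fun x => fβ x.beta * q x * ∏ j, fS (x.missing j) := by
  have hprod : Measurable fun s : Fin Jt → EuclideanSpace ℝ (Fin d) => ∏ j, fS (s j) :=
    Finset.measurable_prod _ fun j _ => hfS.comp (measurable_pi_apply j)
  have hmap : P.map (fun x => (x.beta, x.missing)) =
      volume.withDensity fun z : EuclideanSpace ℝ (Fin p) × (Fin Jt → EuclideanSpace ℝ (Fin d)) =>
        fβ z.1 * ∏ j, fS (z.2 j) := by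
    rw [(indepFun_iff_map_prod_eq_prod_map_map measurable_beta.aemeasurable
      measurable_missing.aemeasurable).1 hind]
    have h1 := Measure.isProbabilityMeasure_map (μ := P)
      (measurable_missing (p := p) (d := d) (Jt := Jt) (k := k)).aemeasurable
    rw [hiid.map_missing hfS] at h1
    rw [hβ, hiid.map_missing hfS, prod_withDensity hfβ hprod]
    rfl
  conv_lhs => rw [hcond.eq_withDensity
    (φ := fun z => fβ z.1 * ∏ j, fS (z.2 j)) hq (measurable_beta.prodMk measurable_missing)
    ((hfβ.comp measurable_fst).mul (hprod.comp measurable_snd)) hmap]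
  congr 1
  funext x
  exact mul_right_comm _ _ _

end MomentModel

end

/-! ### Densities on the parameter space -/

noncomputable section

open EuclideanSpace Matrix Module Set

namespace MomentModel

variable {p d Jt k : ℕ} {M : MomentModel p d k}

/-- Up to sign, `A⁻¹ H` is a block of columns of the slope, and the invertible `A⁻¹` does not change
the rank of `H`. -/
theorem rank_slope (x : FullParam p d Jt k) (hdet : IsUnit (M.meanJac x).det)
    (hH : (M.H x).rank = p) : (M.slope x).rank = Fintype.card (Fin p) := by
  refine le_antisymm (rank_le_card_height _) ?_
  have h1 : M.slope x * fromRows (-1 : Matrix (Fin Jt ⊕ Fin k) (Fin Jt ⊕ Fin k) ℝ)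
      (0 : Matrix (Fin Jt × Fin d) (Fin Jt ⊕ Fin k) ℝ) = (M.meanJac x)⁻¹ * M.H x := by
    rw [slope, fromCols_mul_fromRows, Matrix.mul_zero, add_zero, Matrix.mul_neg, Matrix.mul_one,
      JTheta, neg_neg]
  have hu : IsUnit ((M.meanJac x)⁻¹).det := by
    rw [det_nonsing_inv]; exact hdet.ringInverse
  rw [Fintype.card_fin]
  calc p = ((M.meanJac x)⁻¹ * M.H x).rank := by
        rw [rank_mul_eq_right_of_isUnit_det _ _ hu, hH]
    _ ≤ _ := by rw [← h1]; exact rank_mul_le_left _ _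

theorem slope_eq (x : FullParam p d Jt k) :
    M.slope x = -((M.meanJac x)⁻¹ * fromCols (M.H x) (M.Mtilde x)) := by
  rw [slope, mul_fromCols, fromCols_neg]; rfl

/-- `A`, `H` and `M̃` are read off from the derivative of the moment, which is continuous along `Θ`.
This yields the measurability of the coarea factor. -/
theorem continuousOn_slope
    (hg_missing : ∀ x ∈ M.paramSpace Jt, ∀ j : Fin Jt,
      ContDiffAt ℝ 1
        (fun z : EuclideanSpace ℝ (Fin d) × EuclideanSpace ℝ (Fin p) => M.g z.1 z.2)
        (x.missing j, x.beta))
    (hg_obs : ∀ x ∈ M.paramSpace Jt, ∀ i : Fin (k + 1), ContDiffAt ℝ 1 (M.g (M.s i)) x.beta)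
    (hdet : ∀ x ∈ M.paramSpace Jt, IsUnit (M.meanJac x).det) :
    ContinuousOn (M.slope (Jt := Jt)) (M.paramSpace Jt) := by
  have hF : ContinuousOn (fderiv ℝ (M.moment (Jt := Jt))) (M.paramSpace Jt) :=
    continuousOn_of_hasStrictFDerivAt fun x hx =>
      (contDiffAt_moment hg_missing hg_obs hx).hasStrictFDerivAt one_ne_zero
  have hFv : ∀ (v : FullParam p d Jt k) (r : Fin p),
      ContinuousOn (fun x => (fderiv ℝ (M.moment (Jt := Jt)) x v) r) (M.paramSpace Jt) :=
    fun v r => (EuclideanSpace.proj r : _ →L[ℝ] ℝ).continuous.comp_continuousOn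
      (hF.clm_apply continuousOn_const)
  have hA : ContinuousOn (M.meanJac (Jt := Jt)) (M.paramSpace Jt) := by
    refine continuousOn_pi.2 fun r => continuousOn_pi.2 fun c => ?_
    refine (hFv (glueL (EuclideanSpace.single c 1, 0)) r).congr fun x hx => ?_
    beta_reduce
    rw [ofLp_fderiv_moment hg_missing hg_obs hx, ← fstL_eq_beta, ← sndL_eq_free, fstL_glueL,
      sndL_glueL]
    simp
  have hHM : ContinuousOn (fun x : FullParam p d Jt k => fromCols (M.H x) (M.Mtilde x))
      (M.paramSpace Jt) := by
    refine continuousOn_pi.2 fun r => continuousOn_pi.2 fun c => ?_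
    refine (hFv (glueL (0, EuclideanSpace.single c 1)) r).congr fun x hx => ?_
    beta_reduce
    rw [ofLp_fderiv_moment hg_missing hg_obs hx, ← fstL_eq_beta, ← sndL_eq_free, fstL_glueL,
      sndL_glueL]
    simp
  have hAinv : ContinuousOn (fun x : FullParam p d Jt k => (M.meanJac x)⁻¹) (M.paramSpace Jt) := by
    simp_rw [Matrix.inv_def, Ring.inverse_eq_inv']
    exact ((continuous_id.matrix_det.comp_continuousOn hA).inv₀ fun x hx =>
      (hdet x hx).ne_zero).smul (continuous_id.matrix_adjugate.comp_continuousOn hA)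
  have hmul : Continuous fun z : Matrix (Fin p) (Fin p) ℝ ×
      Matrix (Fin p) ((Fin Jt ⊕ Fin k) ⊕ (Fin Jt × Fin d)) ℝ => -(z.1 * z.2) :=
    (continuous_fst.matrix_mul continuous_snd).neg
  exact (hmul.comp_continuousOn (hAinv.prodMk hHM)).congr fun x _ => slope_eq x

/-- The implicit function stays in `Θ` nearby, because `β` is interior and positivity of the
probabilities is open. Uniqueness then identifies `b` with its first block, so continuity of `b`
need not be assumed. -/
theorem hasFDerivAt_beta (hB : MeasurableSet M.betaSet)
    (hg_missing : ∀ x ∈ M.paramSpace Jt, ∀ j : Fin Jt,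
      ContDiffAt ℝ 1
        (fun z : EuclideanSpace ℝ (Fin d) × EuclideanSpace ℝ (Fin p) => M.g z.1 z.2)
        (x.missing j, x.beta))
    (hg_obs : ∀ x ∈ M.paramSpace Jt, ∀ i : Fin (k + 1), ContDiffAt ℝ 1 (M.g (M.s i)) x.beta)
    (hdet : ∀ x ∈ M.paramSpace Jt, IsUnit (M.meanJac x).det)
    {b : FreeParam d Jt k → EuclideanSpace ℝ (Fin p)}
    (hb : ∀ x ∈ M.paramSpace Jt, x.beta = b x.free)
    {x : FullParam p d Jt k} (hx : x ∈ M.paramSpace Jt) (hint : M.betaSet ∈ 𝓝 x.beta) :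
    HasFDerivAt b (LinearMap.toContinuousLinearMap (Matrix.toEuclideanLin (M.slope x))) x.free := by
  have hG := isImplicitGraph hB hg_missing hg_obs hdet
  obtain ⟨W, hW, f, hfc, hfz, hf, hf'⟩ := exists_local_parametrization hG.hasStrictFDerivAt sndL hx
    (hG.zero x hx) (hG.bijective_prod_sndL hx)
  have hfx : f (sndL x) = x := hf x (mem_of_mem_nhds hW) (hG.zero x hx)
  obtain ⟨f', hfd, h1, h2⟩ := hf' x ⟨hx, mem_of_mem_nhds hW⟩ (hG.zero x hx)
  have hlim : Filter.Tendsto f (𝓝 (sndL x)) (𝓝 x) := by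
    have : Filter.Tendsto f (𝓝 (sndL x)) (𝓝 (f (sndL x))) := hfc
    rwa [hfx] at this
  have hθlast : Continuous fun x : FullParam p d Jt k => x.free.thetaLast := by
    simp_rw [thetaLast_eq]
    exact continuous_const.add (thetaLastL p d Jt k).continuous
  have hev : ∀ᶠ y in 𝓝 x, y.beta ∈ M.betaSet ∧ (∀ c, 0 < y.free.theta c) ∧
      0 < y.free.thetaLast := by
    refine Filter.Eventually.and ?_ (Filter.Eventually.and ?_ ?_)
    · exact (fstL : FullParam p d Jt k →L[ℝ] _).continuous.continuousAt.eventually_mem hint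
    · exact Filter.eventually_all.2 fun c =>
        (thetaL p d Jt k c).continuous.continuousAt.eventually_const_lt (hx.2.1 c)
    · exact hθlast.continuousAt.eventually_const_lt hx.2.2.1
  have heq : b =ᶠ[𝓝 (sndL x)] fun l => fstL (f l) := by
    filter_upwards [hfz, hlim.eventually hev] with l hl hl'
    have hmem : f l ∈ M.paramSpace Jt := ⟨hl'.1, hl'.2.1, hl'.2.2, hl.1⟩
    have := hb _ hmem
    rw [← sndL_eq_free, hl.2] at this
    exact this.symm
  have hder : fstL.comp f' = LinearMap.toContinuousLinearMap (Matrix.toEuclideanLin (M.slope x)) := by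
    ext v r
    have := hG.ofLp_apply_of_comp_eq hx h1 h2 v
    rw [fromRows_mulVec] at this
    exact congrFun this (Sum.inl r)
  rw [← hder]
  exact (fstL.hasFDerivAt.comp (sndL x) hfd.hasFDerivAt).congr_of_eventuallyEq heq

theorem hausdorff_eq : M.hausdorff Jt =
    (μHE[Fintype.card ((Fin Jt ⊕ Fin k) ⊕ (Fin Jt × Fin d))] :
      Measure (FullParam p d Jt k)).restrict (M.paramSpace Jt) := by
  have : Fintype.card ((Fin Jt ⊕ Fin k) ⊕ (Fin Jt × Fin d)) = (Jt + k) + Jt * d := by simp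
  rw [this, hausdorff]

/-- The area formula for graphs, applied to the part of `Θ` above each Borel set `A`, with `σ`
restoring `β` by means of `b`. -/
theorem map_free_eq_withDensity (hB : MeasurableSet M.betaSet)
    (hg_missing : ∀ x ∈ M.paramSpace Jt, ∀ j : Fin Jt,
      ContDiffAt ℝ 1
        (fun z : EuclideanSpace ℝ (Fin d) × EuclideanSpace ℝ (Fin p) => M.g z.1 z.2)
        (x.missing j, x.beta))
    (hg_obs : ∀ x ∈ M.paramSpace Jt, ∀ i : Fin (k + 1), ContDiffAt ℝ 1 (M.g (M.s i)) x.beta)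
    (hdet : ∀ x ∈ M.paramSpace Jt, IsUnit (M.meanJac x).det)
    {b : FreeParam d Jt k → EuclideanSpace ℝ (Fin p)}
    (hb : ∀ x ∈ M.paramSpace Jt, x.beta = b x.free) (h : FullParam p d Jt k → ℝ≥0∞) :
    ((M.hausdorff Jt).withDensity h).map FullParam.free = volume.withDensity
      ((FullParam.free '' M.paramSpace Jt).indicator fun l =>
        ENNReal.ofReal (Real.sqrt (M.gram (WithLp.toLp 2 (Sum.elim (b l) l)) + 1).det)
          * h (WithLp.toLp 2 (Sum.elim (b l) l))) := by
  have hG := isImplicitGraph hB hg_missing hg_obs hdet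
  have hfree : Measurable (FullParam.free : FullParam p d Jt k → _) := sndL.continuous.measurable
  set σ : FreeParam d Jt k → FullParam p d Jt k := fun l => WithLp.toLp 2 (Sum.elim (b l) l)
  have hσ : ∀ x ∈ M.paramSpace Jt, σ (sndL x) = x := fun x hx => by
    have h1 : σ (sndL x) = glueL (b (sndL x), sndL x) := rfl
    have h2 : b (sndL x) = fstL x := (hb x hx).symm
    rw [h1, h2, glueL_fstL_sndL]
  have hm : MeasurableSet (FullParam.free '' M.paramSpace Jt) := (hG.lintegral_eq hσ).1
  ext A hA
  have hAm : MeasurableSet (FullParam.free ⁻¹' A : Set (FullParam p d Jt k)) := hfree hA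
  have hT := (hG.mono (hAm.inter hG.measurableSet) inter_subset_right).lintegral_eq
    (σ := σ) fun x hx => hσ x hx.2
  rw [Measure.map_apply hfree hA, withDensity_apply _ hAm, withDensity_apply _ hA, hausdorff_eq,
    Measure.restrict_restrict hAm, hT.2, setLIntegral_indicator hm]
  have himage : sndL '' (FullParam.free ⁻¹' A ∩ M.paramSpace Jt) =
      FullParam.free '' M.paramSpace Jt ∩ A := by
    rw [inter_comm]; exact image_inter_preimage _ _ _
  rw [himage]
  refine lintegral_congr fun l => ?_
  rw [gram_eq]

theorem slicedHausdorff_eq (hB : MeasurableSet M.betaSet)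
    (hg_missing : ∀ x ∈ M.paramSpace Jt, ∀ j : Fin Jt,
      ContDiffAt ℝ 1
        (fun z : EuclideanSpace ℝ (Fin d) × EuclideanSpace ℝ (Fin p) => M.g z.1 z.2)
        (x.missing j, x.beta))
    (hg_obs : ∀ x ∈ M.paramSpace Jt, ∀ i : Fin (k + 1), ContDiffAt ℝ 1 (M.g (M.s i)) x.beta)
    (hdet : ∀ x ∈ M.paramSpace Jt, IsUnit (M.meanJac x).det)
    (hH : ∀ x ∈ M.paramSpace Jt, (M.H x).rank = p) :
    M.slicedHausdorff Jt = (M.hausdorff Jt).withDensity fun x =>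
      ENNReal.ofReal (Real.sqrt (M.gram x).det / Real.sqrt (M.gram x + 1).det) := by
  have hcard : Fintype.card ((Fin Jt ⊕ Fin k) ⊕ (Fin Jt × Fin d)) = (Jt + k) + Jt * d := by simp
  have := (isImplicitGraph hB hg_missing hg_obs hdet).bind_slices_eq
    fun x hx => rank_slope x (hdet x hx) (hH x hx)
  rw [← hausdorff_eq, hcard, Fintype.card_fin] at this
  simp_rw [gram_eq]
  exact this

theorem slicedHausdorff_withDensity_eq (hB : MeasurableSet M.betaSet)
    (hg_missing : ∀ x ∈ M.paramSpace Jt, ∀ j : Fin Jt,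
      ContDiffAt ℝ 1
        (fun z : EuclideanSpace ℝ (Fin d) × EuclideanSpace ℝ (Fin p) => M.g z.1 z.2)
        (x.missing j, x.beta))
    (hg_obs : ∀ x ∈ M.paramSpace Jt, ∀ i : Fin (k + 1), ContDiffAt ℝ 1 (M.g (M.s i)) x.beta)
    (hdet : ∀ x ∈ M.paramSpace Jt, IsUnit (M.meanJac x).det)
    (hH : ∀ x ∈ M.paramSpace Jt, (M.H x).rank = p) {h : FullParam p d Jt k → ℝ≥0∞}
    (hh : Measurable h) :
    (M.slicedHausdorff Jt).withDensity h = (M.hausdorff Jt).withDensity fun x =>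
      ENNReal.ofReal (Real.sqrt (M.gram x).det / Real.sqrt (M.gram x + 1).det) * h x := by
  rw [slicedHausdorff_eq hB hg_missing hg_obs hdet hH]
  -- Composing densities requires the coarea factor to be a.e. measurable. It is continuous on the
  -- Borel set `Θ`, its denominator being positive.
  refine (withDensity_mul₀ ?_ hh.aemeasurable).symm
  have hc := continuousOn_slope hg_missing hg_obs hdet
  refine ContinuousOn.aemeasurable ?_
    (isImplicitGraph hB hg_missing hg_obs hdet).measurableSet
  have hgram : ContinuousOn (M.gram (Jt := Jt)) (M.paramSpace Jt) := by
    have hmul : Continuous fun J : Matrix (Fin p) ((Fin Jt ⊕ Fin k) ⊕ (Fin Jt × Fin d)) ℝ =>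
        J * Jᵀ := continuous_id.matrix_mul continuous_id.matrix_transpose
    exact (hmul.comp_continuousOn hc).congr fun x _ => M.gram_eq x
  have hdet1 : Continuous fun G : Matrix (Fin p) (Fin p) ℝ => Real.sqrt G.det :=
    Real.continuous_sqrt.comp continuous_id.matrix_det
  have hdet2 : Continuous fun G : Matrix (Fin p) (Fin p) ℝ => Real.sqrt (G + 1).det :=
    hdet1.comp (continuous_id.add continuous_const)
  refine ENNReal.continuous_ofReal.comp_continuousOn
    ((hdet1.comp_continuousOn hgram).div (hdet2.comp_continuousOn hgram) fun x _ => ?_)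
  rw [gram_eq]
  exact (Real.sqrt_pos.2 (Matrix.det_mul_transpose_add_one_pos _)).ne'

end MomentModel

end

theorem mainTheorem3 {p d Jt k : ℕ} (M : MomentModel p d k)
    (hB : MeasurableSet M.betaSet)
    -- `g` is continuously differentiable near the points where it is used
    (hg_missing : ∀ x ∈ M.paramSpace Jt, ∀ j : Fin Jt,
      ContDiffAt ℝ 1
        (fun z : EuclideanSpace ℝ (Fin d) × EuclideanSpace ℝ (Fin p) => M.g z.1 z.2)
        (x.missing j, x.beta))
    (hg_obs : ∀ x ∈ M.paramSpace Jt, ∀ i : Fin (k + 1), ContDiffAt ℝ 1 (M.g (M.s i)) x.beta)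
    (hdet : ∀ x ∈ M.paramSpace Jt, IsUnit (M.meanJac x).det)
    (fS : EuclideanSpace ℝ (Fin d) → ℝ≥0∞) (hfS : Measurable fS) :
    -- i.i.d. missing points and a conditional density `q` of `(β, θ*)` given `S̃` yield the
    -- joint Hausdorff density of `(β, θ*, S̃)`
    (∀ (P : Measure (FullParam p d Jt k)) [IsProbabilityMeasure P]
        (q : FullParam p d Jt k → ℝ≥0∞), Measurable q →
        MomentModel.MissingIID P fS →
        IsCondDensity P FullParam.missing (M.hausdorff Jt) q →
        P = (M.hausdorff Jt).withDensity fun x => (∏ j, fS (x.missing j)) * q x) ∧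
    -- `β` is uniquely determined by `(θ*, S̃)`, namely `β = b (θ*, S̃)`
    (∀ b : FreeParam d Jt k → EuclideanSpace ℝ (Fin p),
        (∀ x ∈ M.paramSpace Jt, x.beta = b x.free) →
        -- the Jacobians `∂β/∂θ*'` and `∂β/∂S̃'`
        (∀ x ∈ M.paramSpace Jt, M.betaSet ∈ 𝓝 x.beta →
          HasFDerivAt b (LinearMap.toContinuousLinearMap
            (Matrix.toEuclideanLin (Matrix.fromCols (M.JTheta x) (M.JS x)))) x.free) ∧
        -- the Lebesgue density of `(θ*, S̃)`
        (∀ (P : Measure (FullParam p d Jt k)) [IsProbabilityMeasure P]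
          (q : FullParam p d Jt k → ℝ≥0∞), Measurable q →
          P = (M.hausdorff Jt).withDensity (fun x => (∏ j, fS (x.missing j)) * q x) →
          P.map FullParam.free = volume.withDensity
            ((FullParam.free '' M.paramSpace Jt).indicator fun l =>
              let x : FullParam p d Jt k := WithLp.toLp 2 (Sum.elim (b l) l)
              ENNReal.ofReal (Real.sqrt (M.gram x + 1).det)
                * (∏ j, fS (l.missing j)) * q x))) ∧
    -- the joint method
    ((∀ x ∈ M.paramSpace Jt, (M.H x).rank = p) →
      ∀ (P : Measure (FullParam p d Jt k)) [IsProbabilityMeasure P]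
        (fβ : EuclideanSpace ℝ (Fin p) → ℝ≥0∞) (q : FullParam p d Jt k → ℝ≥0∞),
        Measurable fβ → Measurable q →
        -- `β` has density `fβ` and is independent of the i.i.d. points `S̃`, and `q` is a
        -- conditional density of `θ*` given `(β, S̃)`
        (P.map FullParam.beta = volume.withDensity fβ →
          MomentModel.MissingIID P fS →
          IndepFun FullParam.beta FullParam.missing P →
          IsCondDensity P (fun x => (x.beta, x.missing)) (M.slicedHausdorff Jt) q →
          P = (M.slicedHausdorff Jt).withDensity
            fun x => fβ x.beta * q x * ∏ j, fS (x.missing j)) ∧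
        (P = (M.slicedHausdorff Jt).withDensity
            (fun x => fβ x.beta * q x * ∏ j, fS (x.missing j)) →
          P = (M.hausdorff Jt).withDensity fun x =>
            ENNReal.ofReal (Real.sqrt (M.gram x).det / Real.sqrt (M.gram x + 1).det)
              * fβ x.beta * q x * ∏ j, fS (x.missing j))) := by
  refine ⟨fun P _ q hq hiid hcond =>
      MomentModel.eq_withDensity_of_condDensity_missing hfS P q hq hiid hcond,
    fun b hb => ⟨fun x hx hint =>
      MomentModel.hasFDerivAt_beta hB hg_missing hg_obs hdet hb hx hint, fun P _ q hq hP => ?_⟩,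
    fun hH P _ fβ q hfβ hq => ⟨fun hβ hiid hind hcond =>
      MomentModel.eq_withDensity_of_condDensity_beta_missing hfS P fβ q hfβ hq hβ hiid hind hcond,
      fun hP => ?_⟩⟩
  · have hmap := MomentModel.map_free_eq_withDensity hB hg_missing hg_obs hdet hb
      fun x => (∏ j, fS (x.missing j)) * q x
    rw [← hP] at hmap
    rw [hmap]
    congr 2
    funext l
    exact (mul_assoc _ _ _).symm
  · have hmeas : Measurable fun x : FullParam p d Jt k =>
        fβ x.beta * q x * ∏ j, fS (x.missing j) :=
      ((hfβ.comp MomentModel.measurable_beta).mul hq).mul (Finset.measurable_prod _ fun j _ =>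
        hfS.comp (MomentModel.measurable_missing_apply j))
    conv_lhs => rw [hP]
    rw [MomentModel.slicedHausdorff_withDensity_eq hB hg_missing hg_obs hdet hH hmeas]
    congr 1
    funext x
    simp only [mul_assoc]
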